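/- Let $(M,\omega)$ be an $n$-plectic manifold, i.e. a smooth manifold $M$ with a closed form $\omega\in\Omega^{n+1}(M)$ that is nondegenerate ($\iota_u\omega=0$ implies $u=0$ for every tangent vector $u$). Let a finite-dimensional real Lie algebra $\mathfrak g$ act on $M$ by a Lie algebra homomorphism $\mathfrak g\to\mathfrak X(M)$, $x\mapsto v_x$, preserving $\omega$, i.e. $\pounds_{v_x}\omega=0$ for all $x\in\mathfrak g$. For $p=x_1\wedge\dots\wedge x_k\in\Lambda^k\mathfrak g$ put $\iota_{v_p}\omega=\iota_{v_{x_k}}\cdots\iota_{v_{x_1}}\omega=\omega(v_{x_1},\dots,v_{x_k},\,\cdot\,)$, $\mathrm{ad}_xp=\sum_i x_1\wedge\dots\wedge[x,x_i]\wedge\dots\wedge x_k$ and $\delta p=\sum_{i<j}(-1)^{i+j}[x_i,x_j]\wedge x_1\wedge\dots\widehat{x_i}\dots\widehat{x_j}\dots\wedge x_k$, extended linearly, and let $\zeta(k)=-(-1)^{k(k+1)/2}$. A homotopy moment map is a collection of linear maps $f_k:\Lambda^k\mathfrak g\to\Omega^{n-k}(M)$, $1\le k\le n$, such that, with $f_0=f_{n+1}=0$,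 $$-f_{k-1}(\delta p)=d f_k(p)+\zeta(k)\,\iota_{v_p}\omega\qquad\text{for all }p\in\Lambda^k\mathfrak g,\ 1\le k\le n+1.$$ It is $\mathfrak g$-equivariant if $f_k(\mathrm{ad}_xp)=\pounds_{v_x}f_k(p)$ for all $x\in\mathfrak g$, $p\in\Lambda^k\mathfrak g$, $1\le k\le n$. Let $\widetilde C=\Lambda^{\ge1}\mathfrak g^*\otimes\Omega(M)$ with the differential $\widetilde d_{tot}=d_{\mathfrak g}\otimes1+1\otimes d$, where $d_{\mathfrak g}\alpha=\alpha\circ\delta$ and $1\otimes d$ acts on $\Lambda^k\mathfrak g^*\otimes\Omega(M)$ as $(-1)^kd$, and with the $\mathfrak g$-module structure $(x\cdot\alpha)(p)=\pounds_{v_x}(\alpha(p))-\alpha(\mathrm{ad}_xp)$. Let $\widetilde\omega=\sum_{k=1}^{n+1}(-1)^{k-1}\omega_k\in\widetilde C$, where $\omega_k(p)=\iota_{v_p}\omega$ for $p\in\Lambda^k\mathfrak g$, and let $\mathcal N=\ker\widetilde d_{tot}\subseteq\widetilde C$, which is a $\mathfrak g$-submodule. Let $f$ be a homotopy moment map and let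 $\widetilde\alpha=\sum_{k=1}^n\zeta(k)f_k\in\widetilde C$ be the corresponding potential of $\widetilde\omega$, so that $\widetilde d_{tot}\widetilde\alpha=\widetilde\omega$. Then $x\cdot\widetilde\alpha\in\mathcal N$ for all $x\in\mathfrak g$, and the linear map $d_{\mathfrak g,\widetilde C}\widetilde\alpha:\mathfrak g\to\mathcal N$, $x\mapsto x\cdot\widetilde\alpha$, is a Lie algebra $1$-cocycle with values in $\mathcal N$. Its class in $H^1(\mathfrak g,\mathcal N)$ does not depend on the choice of the homotopy moment map $f$, and it vanishes if and only if there exists a $\mathfrak g$-equivariant homotopy moment map. -/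

import Mathlib

set_option linter.unusedSectionVars false

open scoped Manifold ContDiff Bundle Topology

namespace Multisymplectic

section Forms

variable {E : Type*} [NormedAddCommGroup E] [NormedSpace ℝ E] [FiniteDimensional ℝ E]

/-! ### Smoothness of maps into spaces of alternating forms -/

theorem contDiffAt_alternating_iff {D : Type*} [NormedAddCommGroup D] [NormedSpace ℝ D] {k : ℕ}
    {r : WithTop ℕ∞} {F : D → E [⋀^Fin k]→L[ℝ] ℝ} {y : D} :
    ContDiffAt ℝ r F y ↔ ∀ v : Fin k → E, ContDiffAt ℝ r (fun z ↦ F z v) y := by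
  constructor
  · intro h v
    have h' : ContDiffAt ℝ r (fun z ↦ (F z).toContinuousMultilinearMap) y :=
      ((ContinuousAlternatingMap.toContinuousMultilinearMapCLM ℝ :
        (E [⋀^Fin k]→L[ℝ] ℝ) →L[ℝ] _).contDiff (n := r)).contDiffAt.comp y h
    exact (ContinuousMultilinearMap.apply ℝ (fun _ : Fin k ↦ E) ℝ v).contDiff.contDiffAt.comp y h'
  · intro h
    let b := Module.finBasis ℝ E
    let Φ : (E [⋀^Fin k]→L[ℝ] ℝ) →ₗ[ℝ] ((Fin k → Fin (Module.finrank ℝ E)) → ℝ) :=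
      { toFun := fun f c ↦ f (fun i ↦ b (c i))
        map_add' := fun _ _ ↦ rfl
        map_smul' := fun _ _ ↦ rfl }
    have hΦ : LinearMap.ker Φ = ⊥ := by
      rw [LinearMap.ker_eq_bot]
      intro f g hfg
      apply ContinuousAlternatingMap.toAlternatingMap_injective
      refine Module.Basis.ext_alternating b fun c _ ↦ ?_
      exact congrFun hfg c
    obtain ⟨Ψ, hΨ⟩ := Φ.exists_leftInverse_of_injective hΦ
    have h1 : ContDiffAt ℝ r (fun z ↦ Φ (F z)) y := contDiffAt_pi.2 fun c ↦ h _
    have h2 := (LinearMap.toContinuousLinearMap Ψ).contDiff.contDiffAt.comp y h1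
    have h3 : F = (LinearMap.toContinuousLinearMap Ψ) ∘ fun z ↦ Φ (F z) := by
      funext z
      exact (LinearMap.congr_fun hΨ (F z)).symm
    rw [h3]
    exact h2

theorem contDiffAt_alternating_apply {D : Type*} [NormedAddCommGroup D] [NormedSpace ℝ D] {k : ℕ}
    {r : WithTop ℕ∞} {F : D → E [⋀^Fin k]→L[ℝ] ℝ} {w : D → Fin k → E} {y : D}
    (hF : ContDiffAt ℝ r F y) (hw : ContDiffAt ℝ r w y) :
    ContDiffAt ℝ r (fun z ↦ F z (w z)) y := by
  have h := ((ContinuousAlternatingMap.toContinuousMultilinearMapCLM ℝ (E := E) (F := ℝ)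
    (ι := Fin k)).analyticAt_uncurry_of_multilinear (x := (F y, w y))).contDiffAt (n := r)
  exact h.comp y (hF.prodMk hw)

theorem contDiffAt_alternating_comp {D : Type*} [NormedAddCommGroup D] [NormedSpace ℝ D] {k : ℕ}
    {r : WithTop ℕ∞} {F : D → E [⋀^Fin k]→L[ℝ] ℝ} {g : D → E →L[ℝ] E} {y : D}
    (hF : ContDiffAt ℝ r F y) (hg : ContDiffAt ℝ r g y) :
    ContDiffAt ℝ r (fun z ↦ (F z).compContinuousLinearMap (g z)) y := by
  rw [contDiffAt_alternating_iff]
  intro v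
  refine contDiffAt_alternating_apply (w := fun z i ↦ g z (v i)) hF ?_
  exact contDiffAt_pi.2 fun i ↦ hg.clm_apply contDiffAt_const

/-! ### Vector fields and differential forms on a manifold -/

variable {M : Type*} [TopologicalSpace M] [ChartedSpace E M] [IsManifold 𝓘(ℝ, E) ∞ M]

/-- Smooth vector fields `𝔛(M)`: smooth sections of the tangent bundle. -/
abbrev VField (E : Type*) [NormedAddCommGroup E] [NormedSpace ℝ E] (M : Type*)
    [TopologicalSpace M] [ChartedSpace E M] [IsManifold 𝓘(ℝ, E) ∞ M] : Type _ :=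
  Cₛ^∞⟮𝓘(ℝ, E); E, (TangentSpace 𝓘(ℝ, E) : M → Type _)⟯

/-- Smooth differential forms `Ωᵏ(M)`: smooth sections of the bundle of alternating `k`-linear
real valued forms on the tangent spaces. -/
abbrev DForm (E : Type*) [NormedAddCommGroup E] [NormedSpace ℝ E] (M : Type*)
    [TopologicalSpace M] [ChartedSpace E M] [IsManifold 𝓘(ℝ, E) ∞ M] (k : ℕ) : Type _ :=
  Cₛ^∞⟮𝓘(ℝ, E); E [⋀^Fin k]→L[ℝ] ℝ,
    fun x : M ↦ (TangentSpace 𝓘(ℝ, E) x) [⋀^Fin k]→L[ℝ] Bundle.Trivial M ℝ x⟯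

/-- Rough (not necessarily smooth) forms. -/
abbrev RForm (E : Type*) [NormedAddCommGroup E] [NormedSpace ℝ E] (M : Type*)
    [TopologicalSpace M] [ChartedSpace E M] (k : ℕ) : Type _ :=
  (x : M) → (TangentSpace 𝓘(ℝ, E) x) [⋀^Fin k]→L[ℝ] ℝ

/-- The inverse of the preferred chart at `x₀`. -/
noncomputable abbrev chartInv (E : Type*) [NormedAddCommGroup E] [NormedSpace ℝ E] {M : Type*}
    [TopologicalSpace M] [ChartedSpace E M] (x₀ : M) : E → M := (extChartAt 𝓘(ℝ, E) x₀).symm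

/-- The derivative of the inverse chart as an operator of the model space. -/
noncomputable def dChartInv (E : Type*) [NormedAddCommGroup E] [NormedSpace ℝ E] {M : Type*}
    [TopologicalSpace M] [ChartedSpace E M] (x₀ : M) (y : E) : E →L[ℝ] E :=
  mfderiv 𝓘(ℝ, E) 𝓘(ℝ, E) (chartInv E x₀) y

/-- The derivative of the chart as an operator of the model space. -/
noncomputable def dChart (E : Type*) [NormedAddCommGroup E] [NormedSpace ℝ E] {M : Type*}
    [TopologicalSpace M] [ChartedSpace E M] (x₀ x : M) : E →L[ℝ] E :=
  mfderiv 𝓘(ℝ, E) 𝓘(ℝ, E) (extChartAt 𝓘(ℝ, E) x₀) x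

/-- The expression of a form in the preferred chart at `x₀`: its pullback along the inverse of
the chart. -/
noncomputable def chartForm {k : ℕ} (x₀ : M) (η : RForm E M k) (y : E) : E [⋀^Fin k]→L[ℝ] ℝ :=
  (show E [⋀^Fin k]→L[ℝ] ℝ from η (chartInv E x₀ y)).compContinuousLinearMap (dChartInv E x₀ y)

/-- The expression of a vector field in the preferred chart at `x₀`. -/
noncomputable def chartField (x₀ : M) (X : (x : M) → TangentSpace 𝓘(ℝ, E) x) (y : E) : E :=
  dChart E x₀ (chartInv E x₀ y) (X (chartInv E x₀ y))

theorem dChart_comp_dChartInv {x₀ : M} {y : E} (hy : y ∈ (extChartAt 𝓘(ℝ, E) x₀).target) :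
    (dChart E x₀ (chartInv E x₀ y)).comp (dChartInv E x₀ y) = ContinuousLinearMap.id ℝ E := by
  have h := mfderiv_extChartAt_comp_mfderivWithin_extChartAt_symm (I := 𝓘(ℝ, E)) hy
  simp only [modelWithCornersSelf_coe, Set.range_id, mfderivWithin_univ] at h
  exact h

theorem dChartInv_comp_dChart {x₀ : M} {y : E} (hy : y ∈ (extChartAt 𝓘(ℝ, E) x₀).target) :
    (dChartInv E x₀ y).comp (dChart E x₀ (chartInv E x₀ y)) = ContinuousLinearMap.id ℝ E := by
  have h := mfderivWithin_extChartAt_symm_comp_mfderiv_extChartAt (I := 𝓘(ℝ, E)) hy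
  simp only [modelWithCornersSelf_coe, Set.range_id, mfderivWithin_univ] at h
  exact h

theorem dChart_self (x : M) : dChart E x x = ContinuousLinearMap.id ℝ E :=
  mfderiv_extChartAt_self

theorem chartInv_self (x : M) : chartInv E x (extChartAt 𝓘(ℝ, E) x x) = x :=
  extChartAt_to_inv x

theorem dChartInv_self (x : M) :
    dChartInv E x (extChartAt 𝓘(ℝ, E) x x) = ContinuousLinearMap.id ℝ E := by
  have h := dChart_comp_dChartInv (E := E) (mem_extChartAt_target (I := 𝓘(ℝ, E)) x)
  rw [chartInv_self, dChart_self] at h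
  simpa using h

/-- Transport of a form along an equality of points. -/
theorem form_congr {k : ℕ} (η : RForm E M k) {p q : M} (h : p = q) (w : Fin k → E) :
    (show E [⋀^Fin k]→L[ℝ] ℝ from η p) w = (show E [⋀^Fin k]→L[ℝ] ℝ from η q) w := by
  subst h; rfl

theorem chartForm_self {k : ℕ} (η : RForm E M k) (x : M) :
    chartForm x η (extChartAt 𝓘(ℝ, E) x x) = (show E [⋀^Fin k]→L[ℝ] ℝ from η x) := by
  ext w
  simp only [chartForm, dChartInv_self]
  exact form_congr η (chartInv_self x) w

theorem field_congr (X : (x : M) → TangentSpace 𝓘(ℝ, E) x) {p q : M} (h : p = q) :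
    (show E from X p) = (show E from X q) := by
  subst h; rfl

theorem chartField_self (X : (x : M) → TangentSpace 𝓘(ℝ, E) x) (x : M) :
    chartField x X (extChartAt 𝓘(ℝ, E) x x) = (show E from X x) := by
  have h : dChart E x (chartInv E x (extChartAt 𝓘(ℝ, E) x x)) = ContinuousLinearMap.id ℝ E := by
    rw [chartInv_self, dChart_self]
  simp only [chartField, h]
  exact field_congr X (chartInv_self x)

/-- The change of charts. -/
noncomputable abbrev trans (E : Type*) [NormedAddCommGroup E] [NormedSpace ℝ E] {M : Type*}
    [TopologicalSpace M] [ChartedSpace E M] (x₀ x₁ : M) : E → E :=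
  extChartAt 𝓘(ℝ, E) x₀ ∘ chartInv E x₁

theorem contDiffAt_trans {x₀ x₁ : M} {y : E} (hy : y ∈ (extChartAt 𝓘(ℝ, E) x₁).target)
    (hy' : chartInv E x₁ y ∈ (extChartAt 𝓘(ℝ, E) x₀).source) :
    ContDiffAt ℝ ∞ (trans E x₀ x₁) y := by
  have h := contDiffWithinAt_ext_coord_change (I := 𝓘(ℝ, E)) (n := ∞) x₀ x₁ (y := y) ⟨hy, hy'⟩
  rw [modelWithCornersSelf_coe, Set.range_id, contDiffWithinAt_univ] at h
  exact h

theorem fderiv_trans {x₀ x₁ : M} {y : E}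
    (hy : y ∈ (extChartAt 𝓘(ℝ, E) x₁).target)
    (hy' : chartInv E x₁ y ∈ (extChartAt 𝓘(ℝ, E) x₀).source) :
    fderiv ℝ (trans E x₀ x₁) y = (dChart E x₀ (chartInv E x₁ y)).comp (dChartInv E x₁ y) := by
  rw [← mfderiv_eq_fderiv]
  have e1 : MDifferentiableAt 𝓘(ℝ, E) 𝓘(ℝ, E) (chartInv E x₁) y := by
    have := mdifferentiableWithinAt_extChartAt_symm (I := 𝓘(ℝ, E)) hy
    rw [modelWithCornersSelf_coe, Set.range_id, mdifferentiableWithinAt_univ] at this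
    exact this
  have e2 : MDifferentiableAt 𝓘(ℝ, E) 𝓘(ℝ, E) (extChartAt 𝓘(ℝ, E) x₀) (chartInv E x₁ y) :=
    mdifferentiableAt_extChartAt (by simpa using hy')
  exact mfderiv_comp y e2 e1

theorem dChartInv_comp_fderiv_trans {x₀ x₁ : M} {y : E}
    (hy : y ∈ (extChartAt 𝓘(ℝ, E) x₁).target)
    (hy' : chartInv E x₁ y ∈ (extChartAt 𝓘(ℝ, E) x₀).source) :
    (dChartInv E x₀ (trans E x₀ x₁ y)).comp (fderiv ℝ (trans E x₀ x₁) y) = dChartInv E x₁ y := by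
  have h1 := fderiv_trans hy hy'
  have h2 := dChartInv_comp_dChart (E := E)
    ((extChartAt 𝓘(ℝ, E) x₀).map_source hy')
  have h3 : chartInv E x₀ (trans E x₀ x₁ y) = chartInv E x₁ y :=
    (extChartAt 𝓘(ℝ, E) x₀).left_inv hy'
  have h4 : chartInv E x₀ (extChartAt 𝓘(ℝ, E) x₀ (chartInv E x₁ y)) = chartInv E x₁ y := h3
  rw [h4] at h2
  rw [h1, ← ContinuousLinearMap.comp_assoc]
  change ((dChartInv E x₀ (extChartAt 𝓘(ℝ, E) x₀ (chartInv E x₁ y))).comp _).comp _ = _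
  rw [h2, ContinuousLinearMap.id_comp]

/-- Expressions of a form in two charts are related by pullback along the change of charts. -/
theorem chartForm_trans {k : ℕ} (η : RForm E M k) {x₀ x₁ : M} {y : E}
    (hy : y ∈ (extChartAt 𝓘(ℝ, E) x₁).target)
    (hy' : chartInv E x₁ y ∈ (extChartAt 𝓘(ℝ, E) x₀).source) :
    chartForm x₁ η y = (chartForm x₀ η (trans E x₀ x₁ y)).compContinuousLinearMap
      (fderiv ℝ (trans E x₀ x₁) y) := by
  have h3 : chartInv E x₀ (trans E x₀ x₁ y) = chartInv E x₁ y :=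
    (extChartAt 𝓘(ℝ, E) x₀).left_inv hy'
  ext w
  simp only [chartForm, ← dChartInv_comp_fderiv_trans hy hy']
  exact form_congr η h3.symm _

theorem eventually_trans {x₀ x₁ : M} {y : E} (hy : y ∈ (extChartAt 𝓘(ℝ, E) x₁).target)
    (hy' : chartInv E x₁ y ∈ (extChartAt 𝓘(ℝ, E) x₀).source) :
    ∀ᶠ z in 𝓝 y, z ∈ (extChartAt 𝓘(ℝ, E) x₁).target ∧
      chartInv E x₁ z ∈ (extChartAt 𝓘(ℝ, E) x₀).source := by
  have h1 := (isOpen_extChartAt_target (I := 𝓘(ℝ, E)) x₁).mem_nhds hy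
  have h2 : ContinuousAt (chartInv E x₁) y := continuousAt_extChartAt_symm'' hy
  have h3 := h2.preimage_mem_nhds ((isOpen_extChartAt_source (I := 𝓘(ℝ, E)) x₀).mem_nhds hy')
  filter_upwards [h1, h3] with z hz hz' using ⟨hz, hz'⟩

theorem contDiffAt_chartForm_of_trans {k : ℕ} {η : RForm E M k} {x₀ x₁ : M} {y : E}
    (hy : y ∈ (extChartAt 𝓘(ℝ, E) x₁).target)
    (hy' : chartInv E x₁ y ∈ (extChartAt 𝓘(ℝ, E) x₀).source)
    (h : ContDiffAt ℝ ∞ (chartForm x₀ η) (trans E x₀ x₁ y)) :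
    ContDiffAt ℝ ∞ (chartForm x₁ η) y := by
  have ht := contDiffAt_trans hy hy'
  have h1 : ContDiffAt ℝ ∞ (fun z ↦ (chartForm x₀ η (trans E x₀ x₁ z)).compContinuousLinearMap
      (fderiv ℝ (trans E x₀ x₁) z)) y :=
    contDiffAt_alternating_comp (h.comp y ht) (ht.fderiv_right (by simp))
  refine h1.congr_of_eventuallyEq ?_
  filter_upwards [eventually_trans hy hy'] with z hz using chartForm_trans η hz.1 hz.2

theorem chartForm_eq_trivialization {k : ℕ} (η : RForm E M k) {x₀ x : M}
    (hx : x ∈ (chartAt E x₀).source) :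
    ((trivializationAt (E [⋀^Fin k]→L[ℝ] ℝ)
      (fun x : M ↦ (TangentSpace 𝓘(ℝ, E) x) [⋀^Fin k]→L[ℝ] Bundle.Trivial M ℝ x) x₀)
        ⟨x, η x⟩).2 = chartForm x₀ η (extChartAt 𝓘(ℝ, E) x₀ x) := by
  rw [FiberBundle.trivializationAt_continuousAlternatingMap_apply]
  have h1 := TangentBundle.symmL_trivializationAt (𝕜 := ℝ) (I := 𝓘(ℝ, E)) hx
  simp only [modelWithCornersSelf_coe, Set.range_id, mfderivWithin_univ] at h1
  have h3 : chartInv E x₀ (extChartAt 𝓘(ℝ, E) x₀ x) = x :=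
    (extChartAt 𝓘(ℝ, E) x₀).left_inv (by simpa using hx)
  ext w
  simp only [ContinuousAlternatingMap.inCoordinates, h1]
  simp only [chartForm]
  refine Eq.trans ?_ (form_congr η h3.symm _)
  have h4 : Bundle.Trivialization.continuousLinearMapAt ℝ
      (trivializationAt ℝ (Bundle.Trivial M ℝ) x₀) x = ContinuousLinearMap.id ℝ ℝ :=
    Bundle.Trivial.continuousLinearMapAt_trivialization ℝ M ℝ x
  rw [h4]
  rfl

theorem isSmooth_iff {k : ℕ} (η : RForm E M k) :
    ContMDiff 𝓘(ℝ, E) (𝓘(ℝ, E).prod 𝓘(ℝ, E [⋀^Fin k]→L[ℝ] ℝ)) ∞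
      (fun x ↦ Bundle.TotalSpace.mk' (E [⋀^Fin k]→L[ℝ] ℝ)
        (E := fun x : M ↦ (TangentSpace 𝓘(ℝ, E) x) [⋀^Fin k]→L[ℝ] Bundle.Trivial M ℝ x) x (η x)) ↔
    ∀ (x₀ : M), ∀ y ∈ (extChartAt 𝓘(ℝ, E) x₀).target, ContDiffAt ℝ ∞ (chartForm x₀ η) y := by
  constructor
  · intro h x₀ y hy
    set x := chartInv E x₀ y with hx
    have h1 := (Bundle.contMDiffAt_section x).1 (h x)
    have h2 : ContDiffAt ℝ ∞ (chartForm x η) (extChartAt 𝓘(ℝ, E) x x) := by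
      have h3 : ContMDiffAt 𝓘(ℝ, E) 𝓘(ℝ, E) ∞ (chartInv E x) (extChartAt 𝓘(ℝ, E) x x) :=
        (contMDiffOn_extChartAt_symm x).contMDiffAt
          ((isOpen_extChartAt_target x).mem_nhds (mem_extChartAt_target x))
      have h1' : ContMDiffAt 𝓘(ℝ, E) 𝓘(ℝ, E [⋀^Fin k]→L[ℝ] ℝ) ∞
          (fun p ↦ ((trivializationAt (E [⋀^Fin k]→L[ℝ] ℝ) (fun x : M ↦
            (TangentSpace 𝓘(ℝ, E) x) [⋀^Fin k]→L[ℝ] Bundle.Trivial M ℝ x) x) ⟨p, η p⟩).2)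
          (chartInv E x (extChartAt 𝓘(ℝ, E) x x)) := by
        rw [chartInv_self]; exact h1
      refine (h1'.comp _ h3).contDiffAt.congr_of_eventuallyEq ?_
      filter_upwards [(isOpen_extChartAt_target (I := 𝓘(ℝ, E)) x).mem_nhds
        (mem_extChartAt_target x)] with z hz
      have h4 : chartInv E x z ∈ (chartAt E x).source := by
        rw [← extChartAt_source 𝓘(ℝ, E)]
        exact (extChartAt 𝓘(ℝ, E) x).map_target hz
      have h5 := chartForm_eq_trivialization (E := E) η h4
      rw [(extChartAt 𝓘(ℝ, E) x).right_inv hz] at h5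
      exact h5.symm
    refine contDiffAt_chartForm_of_trans hy (mem_extChartAt_source x) ?_
    exact h2
  · intro h x
    refine (Bundle.contMDiffAt_section x).2 ?_
    have h1 := (h x _ (mem_extChartAt_target x)).contMDiffAt
    have h2 : ContMDiffAt 𝓘(ℝ, E) 𝓘(ℝ, E) ∞ (extChartAt 𝓘(ℝ, E) x) x := contMDiffAt_extChartAt
    refine (h1.comp x h2).congr_of_eventuallyEq ?_
    filter_upwards [(chartAt E x).open_source.mem_nhds (mem_chart_source E x)] with z hz
    exact chartForm_eq_trivialization η hz

/-- Build a smooth form from a rough form which is smooth in charts. -/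
noncomputable def DForm.mk {k : ℕ} (η : RForm E M k)
    (h : ∀ (x₀ : M), ∀ y ∈ (extChartAt 𝓘(ℝ, E) x₀).target, ContDiffAt ℝ ∞ (chartForm x₀ η) y) :
    DForm E M k :=
  ⟨η, (isSmooth_iff η).2 h⟩

/-- The underlying rough form of a smooth form. -/
noncomputable def DForm.rough {k : ℕ} (η : DForm E M k) : RForm E M k := fun x ↦ η x

theorem DForm.contDiffAt {k : ℕ} (η : DForm E M k) {x₀ : M} {y : E}
    (hy : y ∈ (extChartAt 𝓘(ℝ, E) x₀).target) : ContDiffAt ℝ ∞ (chartForm x₀ η.rough) y :=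
  (isSmooth_iff η.rough).1 η.contMDiff x₀ y hy

theorem DForm.ext_chart {k : ℕ} {η θ : DForm E M k}
    (h : ∀ x : M, chartForm x η.rough (extChartAt 𝓘(ℝ, E) x x) =
      chartForm x θ.rough (extChartAt 𝓘(ℝ, E) x x)) : η = θ := by
  refine ContMDiffSection.ext fun x ↦ ?_
  have := h x
  rw [chartForm_self, chartForm_self] at this
  exact this

/-! ### Exterior derivative -/

theorem two_le_infty : (2 : WithTop ℕ∞) ≤ ∞ := by
  exact WithTop.coe_le_coe.2 (le_top : (2 : ℕ∞) ≤ ⊤)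

/-- The exterior derivative at `x`, computed in the preferred chart at `x`. -/
noncomputable def extDRough {k : ℕ} (η : RForm E M k) : RForm E M (k + 1) := fun x ↦
  (extDeriv (chartForm x η) (extChartAt 𝓘(ℝ, E) x x)).compContinuousLinearMap (dChart E x x)

/-- The exterior derivative may be computed in any chart. -/
theorem chartForm_extDRough {k : ℕ} (η : RForm E M k)
    (h : ∀ (x₀ : M), ∀ y ∈ (extChartAt 𝓘(ℝ, E) x₀).target, ContDiffAt ℝ ∞ (chartForm x₀ η) y)
    {x₀ : M} {y : E} (hy : y ∈ (extChartAt 𝓘(ℝ, E) x₀).target) :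
    chartForm x₀ (extDRough η) y = extDeriv (chartForm x₀ η) y := by
  set x := chartInv E x₀ y with hx
  have hx' : chartInv E x₀ y ∈ (extChartAt 𝓘(ℝ, E) x).source := mem_extChartAt_source x
  have h1 : chartForm x₀ η =ᶠ[𝓝 y] fun z ↦ (chartForm x η (trans E x x₀ z)).compContinuousLinearMap
      (fderiv ℝ (trans E x x₀) z) := by
    filter_upwards [eventually_trans hy hx'] with z hz using chartForm_trans η hz.1 hz.2
  have h2 : DifferentiableAt ℝ (chartForm x η) (trans E x x₀ y) :=
    (h x _ (mem_extChartAt_target x)).differentiableAt (by simp)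
  rw [h1.extDeriv_eq, extDeriv_pullback h2 (contDiffAt_trans hy hx')
    (by simpa using two_le_infty),
    fderiv_trans hy hx']
  rfl

theorem chartForm_add {k : ℕ} (η θ : DForm E M k) (x₀ : M) :
    chartForm x₀ (η + θ).rough = chartForm x₀ η.rough + chartForm x₀ θ.rough := rfl

theorem chartForm_smul {k : ℕ} (c : ℝ) (η : DForm E M k) (x₀ : M) :
    chartForm x₀ (c • η).rough = c • chartForm x₀ η.rough := rfl

/-- The exterior derivative `d : Ωᵏ(M) → Ωᵏ⁺¹(M)`. -/
noncomputable def extD (k : ℕ) : DForm E M k →ₗ[ℝ] DForm E M (k + 1) where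
  toFun η := DForm.mk (extDRough η.rough) fun x₀ y hy ↦ by
    have h1 : chartForm x₀ (extDRough η.rough) =ᶠ[𝓝 y] extDeriv (chartForm x₀ η.rough) := by
      filter_upwards [(isOpen_extChartAt_target (I := 𝓘(ℝ, E)) x₀).mem_nhds hy] with z hz
        using chartForm_extDRough η.rough (fun _ _ ↦ η.contDiffAt) hz
    refine ContDiffAt.congr_of_eventuallyEq ?_ h1
    exact (ContinuousAlternatingMap.alternatizeUncurryFinCLM ℝ E ℝ).contDiff.contDiffAt.comp y
      ((η.contDiffAt hy).fderiv_right (m := ∞) (by simp))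
  map_add' η θ := by
    refine ContMDiffSection.ext fun x ↦ ?_
    have hx := mem_extChartAt_target (I := 𝓘(ℝ, E)) x
    change extDRough (η + θ).rough x = extDRough η.rough x + extDRough θ.rough x
    simp only [extDRough, chartForm_add]
    rw [extDeriv_add ((η.contDiffAt hx).differentiableAt (by simp))
      ((θ.contDiffAt hx).differentiableAt (by simp))]
    rfl
  map_smul' c η := by
    refine ContMDiffSection.ext fun x ↦ ?_
    change extDRough (c • η).rough x = c • extDRough η.rough x
    simp only [extDRough, chartForm_smul]
    rw [extDeriv_smul]
    rfl

theorem chartForm_extD {k : ℕ} (η : DForm E M k) {x₀ : M} {y : E}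
    (hy : y ∈ (extChartAt 𝓘(ℝ, E) x₀).target) :
    chartForm x₀ (extD k η).rough y = extDeriv (chartForm x₀ η.rough) y :=
  chartForm_extDRough η.rough (fun _ _ ↦ η.contDiffAt) hy

/-! ### Contraction with a vector field and Lie derivative -/

theorem chartField_contDiffAt (X : VField E M) {x₀ : M} {y : E}
    (hy : y ∈ (extChartAt 𝓘(ℝ, E) x₀).target) : ContDiffAt ℝ ∞ (chartField x₀ X) y := by
  have hs : chartInv E x₀ y ∈ (chartAt E x₀).source := by
    rw [← extChartAt_source 𝓘(ℝ, E)]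
    exact (extChartAt 𝓘(ℝ, E) x₀).map_target hy
  have h1 := ((trivializationAt E (TangentSpace 𝓘(ℝ, E) : M → Type _) x₀).contMDiffAt_section_iff
    (IB := 𝓘(ℝ, E)) (n := ∞) (s := X) (x₀ := chartInv E x₀ y)
    (by simpa [TangentBundle.trivializationAt_baseSet] using hs)).1 (X.contMDiff _)
  have h2 : ContMDiffAt 𝓘(ℝ, E) 𝓘(ℝ, E) ∞ (chartInv E x₀) y :=
    (contMDiffOn_extChartAt_symm x₀).contMDiffAt ((isOpen_extChartAt_target x₀).mem_nhds hy)
  refine (h1.comp y h2).contDiffAt.congr_of_eventuallyEq ?_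
  filter_upwards [(isOpen_extChartAt_target (I := 𝓘(ℝ, E)) x₀).mem_nhds hy] with z hz
  have hs : chartInv E x₀ z ∈ (chartAt E x₀).source := by
    rw [← extChartAt_source 𝓘(ℝ, E)]
    exact (extChartAt 𝓘(ℝ, E) x₀).map_target hz
  have h3 := TangentBundle.continuousLinearMapAt_trivializationAt (𝕜 := ℝ) (I := 𝓘(ℝ, E)) hs
  have h4 := DFunLike.congr_fun h3 (X (chartInv E x₀ z))
  have h5 := Bundle.Trivialization.continuousLinearMapAt_apply_of_mem (R := ℝ)
    (trivializationAt E (TangentSpace 𝓘(ℝ, E) : M → Type _) x₀) (b := chartInv E x₀ z)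
    (by simpa [TangentBundle.trivializationAt_baseSet] using hs) (X (chartInv E x₀ z))
  exact h4.symm.trans h5

/-- Pointwise contraction of a form with a vector field, inserted in the first slot. -/
noncomputable def iotaRough {k : ℕ} (X : (x : M) → TangentSpace 𝓘(ℝ, E) x)
    (η : RForm E M (k + 1)) : RForm E M k := fun x ↦
  (show E [⋀^Fin (k + 1)]→L[ℝ] ℝ from η x).curryLeft (X x)

theorem chartForm_iotaRough {k : ℕ} (X : (x : M) → TangentSpace 𝓘(ℝ, E) x)
    (η : RForm E M (k + 1)) {x₀ : M} {y : E} (hy : y ∈ (extChartAt 𝓘(ℝ, E) x₀).target) :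
    chartForm x₀ (iotaRough X η) y = (chartForm x₀ η y).curryLeft (chartField x₀ X y) := by
  have h : dChartInv E x₀ y (chartField x₀ X y) = (X (chartInv E x₀ y) : E) :=
    DFunLike.congr_fun (dChartInv_comp_dChart hy) (X (chartInv E x₀ y) : E)
  ext w
  refine congrArg (fun u : Fin (k + 1) → E ↦
    (show E [⋀^Fin (k + 1)]→L[ℝ] ℝ from η (chartInv E x₀ y)) u) (funext fun i ↦ ?_)
  refine Fin.cases ?_ (fun j ↦ ?_) i
  · exact h.symm
  · rfl

/-- The contraction `ι_X : Ωᵏ⁺¹(M) → Ωᵏ(M)`, `(ι_X η)(w₁, …, w_k) = η(X, w₁, …, w_k)`. -/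
noncomputable def iota {k : ℕ} (X : VField E M) : DForm E M (k + 1) →ₗ[ℝ] DForm E M k where
  toFun η := DForm.mk (iotaRough X η.rough) fun x₀ y hy ↦ by
    have h1 : chartForm x₀ (iotaRough X η.rough) =ᶠ[𝓝 y]
        fun z ↦ (chartForm x₀ η.rough z).curryLeft (chartField x₀ X z) := by
      filter_upwards [(isOpen_extChartAt_target (I := 𝓘(ℝ, E)) x₀).mem_nhds hy] with z hz
        using chartForm_iotaRough X η.rough hz
    refine ContDiffAt.congr_of_eventuallyEq ?_ h1
    exact ((ContinuousAlternatingMap.curryLeftLI.toContinuousLinearMap).contDiff.contDiffAt.comp y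
      (η.contDiffAt hy)).clm_apply (chartField_contDiffAt X hy)
  map_add' _ _ := rfl
  map_smul' _ _ := rfl

theorem iota_apply {k : ℕ} (X : VField E M) (η : DForm E M (k + 1)) (x : M)
    (w : Fin k → TangentSpace 𝓘(ℝ, E) x) :
    iota X η x w = η x (Fin.cons (X x) w : Fin (k + 1) → TangentSpace 𝓘(ℝ, E) x) := rfl

theorem chartForm_iota {k : ℕ} (X : VField E M) (η : DForm E M (k + 1)) {x₀ : M} {y : E}
    (hy : y ∈ (extChartAt 𝓘(ℝ, E) x₀).target) :
    chartForm x₀ (iota X η).rough y = (chartForm x₀ η.rough y).curryLeft (chartField x₀ X y) :=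
  chartForm_iotaRough X η.rough hy

/-- The Lie derivative `£_X : Ωᵏ(M) → Ωᵏ(M)` along a vector field, `£_X = d ι_X + ι_X d`
(and `£_X = ι_X d` on functions). -/
noncomputable def lieD (X : VField E M) : (k : ℕ) → DForm E M k →ₗ[ℝ] DForm E M k
  | 0 => iota X ∘ₗ extD 0
  | k + 1 => extD k ∘ₗ iota X + iota X ∘ₗ extD (k + 1)

theorem extD_extD {k : ℕ} (η : DForm E M k) : extD (k + 1) (extD k η) = 0 := by
  refine DForm.ext_chart fun x ↦ ?_
  have hx := mem_extChartAt_target (I := 𝓘(ℝ, E)) x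
  rw [chartForm_extD _ hx]
  have h1 : chartForm x (extD k η).rough =ᶠ[𝓝 (extChartAt 𝓘(ℝ, E) x x)]
      extDeriv (chartForm x η.rough) := by
    filter_upwards [(isOpen_extChartAt_target (I := 𝓘(ℝ, E)) x).mem_nhds hx] with z hz
      using chartForm_extD η hz
  rw [h1.extDeriv_eq, extDeriv_extDeriv_apply (η.contDiffAt hx)
    (by simpa using two_le_infty)]
  rfl

theorem lieD_extD (X : VField E M) {k : ℕ} (η : DForm E M k) :
    lieD X (k + 1) (extD k η) = extD k (lieD X k η) := by
  cases k with
  | zero => simp [lieD, extD_extD]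
  | succ k => simp [lieD, extD_extD]

end Forms

section LieDer

variable {E : Type*} [NormedAddCommGroup E] [NormedSpace ℝ E]

theorem hasFDerivAt_linearIsometry_comp {F G : Type*} [NormedAddCommGroup F] [NormedSpace ℝ F]
    [NormedAddCommGroup G] [NormedSpace ℝ G] (L : F →ₗᵢ[ℝ] G) (β : E → F) (y : E)
    (h : DifferentiableAt ℝ β y) :
    HasFDerivAt (fun z ↦ L (β z)) (L.toContinuousLinearMap.comp (fderiv ℝ β y)) y :=
  L.toContinuousLinearMap.hasFDerivAt.comp y h.hasFDerivAt

theorem fderiv_curryLeft_apply {k : ℕ} {β : E → E [⋀^Fin (k + 1)]→L[ℝ] ℝ} {X : E → E} {y : E}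
    (hβ : DifferentiableAt ℝ β y) (hX : DifferentiableAt ℝ X y) (u : E) (w : Fin k → E) :
    fderiv ℝ (fun z ↦ (β z).curryLeft (X z)) y u w =
      fderiv ℝ β y u (Matrix.vecCons (X y) w) + β y (Matrix.vecCons (fderiv ℝ X y u) w) := by
  have h1 := hasFDerivAt_linearIsometry_comp (G := E →L[ℝ] E [⋀^Fin k]→L[ℝ] ℝ)
    ContinuousAlternatingMap.curryLeftLI β y hβ
  have h2 := (h1.clm_apply hX.hasFDerivAt).fderiv
  refine (congrArg (fun A : E →L[ℝ] E [⋀^Fin k]→L[ℝ] ℝ ↦ A u w) h2).trans ?_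
  simp [add_comm]

theorem map_update_eq {k : ℕ} (β : E [⋀^Fin (k + 1)]→L[ℝ] ℝ) (v : Fin (k + 1) → E)
    (i : Fin (k + 1)) (a : E) :
    β (Function.update v i a) = (-1 : ℤ) ^ (i : ℕ) • β (Matrix.vecCons a (i.removeNth v)) := by
  have h := AlternatingMap.map_insertNth β.toAlternatingMap i a (i.removeNth v)
  rw [Fin.insertNth_removeNth] at h
  exact h

/-- Cartan's formula in a vector space. -/
theorem cartan_local {k : ℕ} {β : E → E [⋀^Fin (k + 1)]→L[ℝ] ℝ} {X : E → E} {y : E}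
    (hβ : DifferentiableAt ℝ β y) (hX : DifferentiableAt ℝ X y) (v : Fin (k + 1) → E) :
    extDeriv (fun z ↦ (β z).curryLeft (X z)) y v + (extDeriv β y).curryLeft (X y) v =
      fderiv ℝ β y (X y) v + ∑ i, β y (Function.update v i (fderiv ℝ X y (v i))) := by
  simp only [extDeriv, ContinuousAlternatingMap.alternatizeUncurryFin_apply,
    ContinuousAlternatingMap.curryLeft_apply_apply, fderiv_curryLeft_apply hβ hX, map_update_eq]
  rw [Fin.sum_univ_succ (n := k + 1)]
  have h (j : Fin (k + 1)) : j.succ.removeNth (Matrix.vecCons (X y) v) =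
      Matrix.vecCons (X y) (j.removeNth v) := by
    funext i
    refine Fin.cases ?_ (fun l ↦ ?_) i
    · simp [Fin.removeNth]
    · simp [Fin.removeNth]
  simp only [h, smul_add, Finset.sum_add_distrib, Matrix.cons_val_zero, Matrix.cons_val_succ,
    Fin.val_succ, Fin.val_zero, pow_succ, pow_zero, one_smul, mul_neg, mul_one, neg_smul,
    Finset.sum_neg_distrib]
  have h0 : Fin.removeNth 0 (Matrix.vecCons (X y) v) = v := by
    funext i; simp [Fin.removeNth]
  rw [h0]
  ring

theorem extDeriv_zero_curryLeft {β : E → E [⋀^Fin 0]→L[ℝ] ℝ} {X : E → E} {y : E}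
    (v : Fin 0 → E) :
    (extDeriv β y).curryLeft (X y) v = fderiv ℝ β y (X y) v := by
  simp only [extDeriv, ContinuousAlternatingMap.alternatizeUncurryFin_apply,
    ContinuousAlternatingMap.curryLeft_apply_apply]
  have h : Fin.removeNth (0 : Fin 1) (Matrix.vecCons (X y) v) = v := by
    funext i; exact i.elim0
  simp [h]

variable [FiniteDimensional ℝ E]
variable {M : Type*} [TopologicalSpace M] [ChartedSpace E M] [IsManifold 𝓘(ℝ, E) ∞ M]

/-- The Lie derivative in coordinates. -/
theorem chartForm_lieD (X : VField E M) {k : ℕ} (η : DForm E M k) {x₀ : M} {y : E}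
    (hy : y ∈ (extChartAt 𝓘(ℝ, E) x₀).target) (v : Fin k → E) :
    chartForm x₀ (lieD X k η).rough y v =
      fderiv ℝ (chartForm x₀ η.rough) y (chartField x₀ X y) v +
        ∑ i, chartForm x₀ η.rough y
          (Function.update v i (fderiv ℝ (chartField x₀ X) y (v i))) := by
  have hη := (η.contDiffAt hy).differentiableAt (by simp)
  have hX := (chartField_contDiffAt X hy).differentiableAt (by simp)
  cases k with
  | zero =>
    rw [lieD, LinearMap.comp_apply, chartForm_iota _ _ hy, chartForm_extD _ hy,
      extDeriv_zero_curryLeft]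
    simp
  | succ k =>
    rw [lieD, LinearMap.add_apply, chartForm_add, LinearMap.comp_apply, LinearMap.comp_apply,
      Pi.add_apply, chartForm_iota _ _ hy, chartForm_extD _ hy, chartForm_extD _ hy]
    have h1 : chartForm x₀ (iota X η).rough =ᶠ[𝓝 y]
        fun z ↦ (chartForm x₀ η.rough z).curryLeft (chartField x₀ X z) := by
      filter_upwards [(isOpen_extChartAt_target (I := 𝓘(ℝ, E)) x₀).mem_nhds hy] with z hz
        using chartForm_iota X η hz
    rw [h1.extDeriv_eq, ← cartan_local hη hX]
    rfl

/-- `Z` is the Lie bracket `[X, Y]` of vector fields. -/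
def IsLieBracket (X Y Z : VField E M) : Prop :=
  ∀ x : M, Z x = VectorField.mlieBracket 𝓘(ℝ, E) X Y x

theorem chartField_inverse (X : VField E M) {x : M} {y : E}
    (hy : y ∈ (extChartAt 𝓘(ℝ, E) x).target) :
    VectorField.mpullbackWithin 𝓘(ℝ, E) 𝓘(ℝ, E) (extChartAt 𝓘(ℝ, E) x).symm X
      (Set.range 𝓘(ℝ, E)) y = chartField x X y := by
  rw [VectorField.mpullbackWithin_apply, modelWithCornersSelf_coe, Set.range_id,
    mfderivWithin_univ]
  have h : (dChartInv E x y).inverse = dChart E x (chartInv E x y) :=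
    ContinuousLinearMap.inverse_eq (dChartInv_comp_dChart hy) (dChart_comp_dChartInv hy)
  exact DFunLike.congr_fun h _

theorem IsLieBracket.chartField {X Y Z : VField E M} (h : IsLieBracket X Y Z) (x : M) :
    chartField x Z (extChartAt 𝓘(ℝ, E) x x) =
      fderiv ℝ (chartField x Y) (extChartAt 𝓘(ℝ, E) x x) (chartField x X (extChartAt 𝓘(ℝ, E) x x)) -
      fderiv ℝ (chartField x X) (extChartAt 𝓘(ℝ, E) x x)
        (chartField x Y (extChartAt 𝓘(ℝ, E) x x)) := by
  have hx := (isOpen_extChartAt_target (I := 𝓘(ℝ, E)) x).mem_nhds (mem_extChartAt_target x)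
  have h1 : Z x = (dChart E x x).inverse (VectorField.lieBracketWithin ℝ
      (VectorField.mpullbackWithin 𝓘(ℝ, E) 𝓘(ℝ, E) (extChartAt 𝓘(ℝ, E) x).symm X Set.univ)
      (VectorField.mpullbackWithin 𝓘(ℝ, E) 𝓘(ℝ, E) (extChartAt 𝓘(ℝ, E) x).symm Y Set.univ)
      Set.univ (extChartAt 𝓘(ℝ, E) x x)) := by
    have h1 := h x
    rw [← VectorField.mlieBracketWithin_univ, VectorField.mlieBracketWithin_apply,
      modelWithCornersSelf_coe, Set.range_id, Set.preimage_univ, Set.univ_inter] at h1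
    exact h1
  rw [chartField_self]
  have e (W : VField E M) : VectorField.mpullbackWithin 𝓘(ℝ, E) 𝓘(ℝ, E)
      (extChartAt 𝓘(ℝ, E) x).symm W Set.univ =ᶠ[𝓝 (extChartAt 𝓘(ℝ, E) x x)]
      Multisymplectic.chartField x W := by
    filter_upwards [hx] with z hz
    have := chartField_inverse W hz
    rwa [modelWithCornersSelf_coe, Set.range_id] at this
  have h2 := Filter.EventuallyEq.lieBracket_vectorField_eq (𝕜 := ℝ) (e X) (e Y)
  have h3 (V W : E → E) : (dChart E x x).inverse (VectorField.lieBracketWithin ℝ V W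
      Set.univ (extChartAt 𝓘(ℝ, E) x x)) =
      VectorField.lieBracket ℝ V W (extChartAt 𝓘(ℝ, E) x x) := by
    rw [dChart_self, ContinuousLinearMap.inverse_id, VectorField.lieBracketWithin_univ]
    rfl
  exact h1.trans ((h3 _ _).trans h2)

theorem lieD_iota {X Y Z : VField E M} (h : IsLieBracket X Y Z) {k : ℕ} (η : DForm E M (k + 1)) :
    lieD X k (iota Y η) = iota Y (lieD X (k + 1) η) + iota Z η := by
  refine DForm.ext_chart fun x ↦ ?_
  have hx := mem_extChartAt_target (I := 𝓘(ℝ, E)) x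
  have hη := (η.contDiffAt hx).differentiableAt (by simp)
  have hY := (chartField_contDiffAt Y hx).differentiableAt (by simp)
  ext v
  rw [chartForm_lieD X _ hx, chartForm_add, Pi.add_apply, chartForm_iota _ _ hx,
    chartForm_iota _ _ hx, chartForm_iota _ _ hx, h.chartField]
  have h1 : chartForm x (iota Y η).rough =ᶠ[𝓝 (extChartAt 𝓘(ℝ, E) x x)]
      fun z ↦ (chartForm x η.rough z).curryLeft (chartField x Y z) := by
    filter_upwards [(isOpen_extChartAt_target (I := 𝓘(ℝ, E)) x).mem_nhds hx] with z hz
      using chartForm_iota Y η hz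
  rw [h1.fderiv_eq, fderiv_curryLeft_apply hη hY, ContinuousAlternatingMap.add_apply,
    ContinuousAlternatingMap.curryLeft_apply_apply, chartForm_lieD X _ hx, Fin.sum_univ_succ]
  simp only [ContinuousAlternatingMap.curryLeft_apply_apply, map_sub,
    ContinuousAlternatingMap.sub_apply]
  simp only [Matrix.cons_val_zero, Matrix.cons_val_succ]
  have e0 (a : E) : Function.update (Matrix.vecCons (chartField x Y (extChartAt 𝓘(ℝ, E) x x)) v)
      0 a = Matrix.vecCons a v := Fin.update_cons_zero ..
  have e1 (a : E) (i : Fin k) :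
      Function.update (Matrix.vecCons (chartField x Y (extChartAt 𝓘(ℝ, E) x x)) v) i.succ a =
      Matrix.vecCons (chartField x Y (extChartAt 𝓘(ℝ, E) x x)) (Function.update v i a) :=
    (Fin.cons_update ..).symm
  simp only [e0, e1]
  ring

theorem lieD_lieD {X Y Z : VField E M} (h : IsLieBracket X Y Z) {k : ℕ} (η : DForm E M k) :
    lieD X k (lieD Y k η) = lieD Y k (lieD X k η) + lieD Z k η := by
  cases k with
  | zero =>
    change lieD X 0 (iota Y (extD 0 η)) = iota Y (extD 0 (lieD X 0 η)) + iota Z (extD 0 η)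
    rw [lieD_iota h, lieD_extD]
  | succ k =>
    have hY (θ : DForm E M (k + 1)) :
      lieD Y (k + 1) θ = extD k (iota Y θ) + iota Y (extD (k + 1) θ) := rfl
    have hZ (θ : DForm E M (k + 1)) :
      lieD Z (k + 1) θ = extD k (iota Z θ) + iota Z (extD (k + 1) θ) := rfl
    rw [hY, hY, hZ, map_add, lieD_extD, lieD_iota h, lieD_iota h, lieD_extD, map_add]
    abel

end LieDer

section Cochains

variable {𝔤 : Type*} [LieRing 𝔤] [LieAlgebra ℝ 𝔤] {V : Type*} [AddCommGroup V] [Module ℝ V]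

/-! ### Alternating cochains on a Lie algebra -/

/-- `(adSum x α)(p₁, …, p_k) = ∑ᵢ α(p₁, …, [x, pᵢ], …, p_k)`, that is, `p ↦ α(ad_x p)`. -/
def adSum {k : ℕ} (x : 𝔤) : (𝔤 [⋀^Fin k]→ₗ[ℝ] V) →ₗ[ℝ] (𝔤 [⋀^Fin k]→ₗ[ℝ] V) where
  toFun α :=
    { toFun := fun p ↦ ∑ i, α (Function.update p i ⁅x, p i⁆)
      map_update_add' := by
        intro inst p i a b
        obtain rfl : inst = instDecidableEqFin k := Subsingleton.elim _ _
        rw [← Finset.sum_add_distrib]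
        refine Finset.sum_congr rfl fun j _ ↦ ?_
        by_cases h : j = i
        · subst h; simp
        · simp only [Function.update_of_ne h, Function.update_comm (Ne.symm h),
            AlternatingMap.map_update_add]
      map_update_smul' := by
        intro inst p i c a
        obtain rfl : inst = instDecidableEqFin k := Subsingleton.elim _ _
        rw [Finset.smul_sum]
        refine Finset.sum_congr rfl fun j _ ↦ ?_
        by_cases h : j = i
        · subst h; simp
        · simp only [Function.update_of_ne h, Function.update_comm (Ne.symm h),
            AlternatingMap.map_update_smul]
      map_eq_zero_of_eq' := by
        intro p i j hp hij
        change ∑ l, α (Function.update p l ⁅x, p l⁆) = 0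
        rw [Fintype.sum_eq_add i j hij]
        · have h : Function.update p j ⁅x, p j⁆ =
              (Function.update p i ⁅x, p i⁆) ∘ (Equiv.swap i j) := by
            funext l
            by_cases h1 : l = i
            · subst h1
              simp [Function.update_of_ne hij, Function.update_of_ne hij.symm, hp]
            · by_cases h2 : l = j
              · subst h2; simp [hp]
              · simp [Equiv.swap_apply_of_ne_of_ne h1 h2, Function.update_of_ne h1,
                  Function.update_of_ne h2]
          rw [h, α.map_swap _ hij, add_neg_cancel]
        · rintro l ⟨hi, hj⟩
          refine α.map_eq_zero_of_eq _ (i := i) (j := j) ?_ hij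
          rw [Function.update_of_ne (Ne.symm hi), Function.update_of_ne (Ne.symm hj), hp] }
  map_add' α β := by
    ext p
    change ∑ i, (α (Function.update p i ⁅x, p i⁆) + β (Function.update p i ⁅x, p i⁆)) =
      ∑ i, α (Function.update p i ⁅x, p i⁆) + ∑ i, β (Function.update p i ⁅x, p i⁆)
    rw [Finset.sum_add_distrib]
  map_smul' c α := by
    ext p
    change ∑ i, c • α (Function.update p i ⁅x, p i⁆) = c • ∑ i, α (Function.update p i ⁅x, p i⁆)
    rw [Finset.smul_sum]

theorem adSum_apply {k : ℕ} (x : 𝔤) (α : 𝔤 [⋀^Fin k]→ₗ[ℝ] V) (p : Fin k → 𝔤) :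
    adSum x α p = ∑ i, α (Function.update p i ⁅x, p i⁆) := rfl

theorem adSum_add {k : ℕ} (x y : 𝔤) (α : 𝔤 [⋀^Fin k]→ₗ[ℝ] V) :
    adSum (x + y) α = adSum x α + adSum y α := by
  ext p
  simp [adSum_apply, Finset.sum_add_distrib]

theorem adSum_smul {k : ℕ} (c : ℝ) (x : 𝔤) (α : 𝔤 [⋀^Fin k]→ₗ[ℝ] V) :
    adSum (c • x) α = c • adSum x α := by
  ext p
  simp [adSum_apply, Finset.smul_sum]

theorem adSum_adSum {k : ℕ} (x y : 𝔤) (α : 𝔤 [⋀^Fin k]→ₗ[ℝ] V) :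
    adSum x (adSum y α) = adSum y (adSum x α) - adSum ⁅x, y⁆ α := by
  ext p
  have key (x y : 𝔤) : adSum x (adSum y α) p =
      ∑ i, α (Function.update p i ⁅y, ⁅x, p i⁆⁆) + ∑ i, ∑ j ∈ Finset.univ.erase i,
        α (Function.update (Function.update p i ⁅x, p i⁆) j ⁅y, p j⁆) := by
    simp only [adSum_apply]
    rw [← Finset.sum_add_distrib]
    refine Finset.sum_congr rfl fun i _ ↦ ?_
    rw [← Finset.add_sum_erase _ _ (Finset.mem_univ i)]
    congr 1
    · simp
    · refine Finset.sum_congr rfl fun j hj ↦ ?_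
      rw [Function.update_of_ne (Finset.ne_of_mem_erase hj)]
  have hsymm : ∑ i, ∑ j ∈ Finset.univ.erase i,
        α (Function.update (Function.update p i ⁅x, p i⁆) j ⁅y, p j⁆) =
      ∑ i, ∑ j ∈ Finset.univ.erase i,
        α (Function.update (Function.update p i ⁅y, p i⁆) j ⁅x, p j⁆) := by
    rw [Finset.sum_comm' (t' := Finset.univ) (s' := fun j ↦ Finset.univ.erase j)
      (by intro i j; simp [eq_comm])]
    refine Finset.sum_congr rfl fun j _ ↦ Finset.sum_congr rfl fun i hi ↦ ?_
    rw [Function.update_comm (Finset.ne_of_mem_erase hi)]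
  rw [AlternatingMap.sub_apply, key x y, key y x, hsymm, adSum_apply]
  have hj : ∑ i, α (Function.update p i ⁅x, ⁅y, p i⁆⁆) =
      ∑ i, α (Function.update p i ⁅y, ⁅x, p i⁆⁆) + ∑ i, α (Function.update p i ⁅⁅x, y⁆, p i⁆) := by
    rw [← Finset.sum_add_distrib]
    refine Finset.sum_congr rfl fun i _ ↦ ?_
    rw [leibniz_lie x y, AlternatingMap.map_update_add, add_comm]
  rw [hj]
  abel

/-- The Lie algebra acts on alternating cochains with values in a representation `ρ`:
`(x · α)(p) = x · α(p) - α(ad_x p)`. -/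
def cochainAct (ρ : 𝔤 →ₗ[ℝ] V →ₗ[ℝ] V) {k : ℕ} (x : 𝔤) :
    (𝔤 [⋀^Fin k]→ₗ[ℝ] V) →ₗ[ℝ] (𝔤 [⋀^Fin k]→ₗ[ℝ] V) where
  toFun α := (ρ x).compAlternatingMap α - adSum x α
  map_add' α β := by
    ext p
    simp only [map_add, AlternatingMap.sub_apply, AlternatingMap.add_apply,
      LinearMap.compAlternatingMap_apply]
    abel
  map_smul' c α := by
    ext p
    simp [smul_sub]

theorem cochainAct_apply (ρ : 𝔤 →ₗ[ℝ] V →ₗ[ℝ] V) {k : ℕ} (x : 𝔤) (α : 𝔤 [⋀^Fin k]→ₗ[ℝ] V)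
    (p : Fin k → 𝔤) :
    cochainAct ρ x α p = ρ x (α p) - ∑ i, α (Function.update p i ⁅x, p i⁆) := rfl

theorem cochainAct_lie (ρ : 𝔤 →ₗ[ℝ] V →ₗ[ℝ] V)
    (hρ : ∀ x y m, ρ x (ρ y m) = ρ y (ρ x m) + ρ ⁅x, y⁆ m) {k : ℕ} (x y : 𝔤)
    (α : 𝔤 [⋀^Fin k]→ₗ[ℝ] V) :
    cochainAct ρ x (cochainAct ρ y α) = cochainAct ρ y (cochainAct ρ x α) +
      cochainAct ρ ⁅x, y⁆ α := by
  have hc (a b : 𝔤) : adSum a ((ρ b).compAlternatingMap α) =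
      (ρ b).compAlternatingMap (adSum a α) := by
    ext p
    simp [adSum_apply]
  have h1 := adSum_adSum x y α
  ext p
  have h2 := congrArg (fun β : 𝔤 [⋀^Fin k]→ₗ[ℝ] V ↦ β p) h1
  simp only [cochainAct, LinearMap.coe_mk, AddHom.coe_mk, map_sub, hc,
    AlternatingMap.sub_apply, AlternatingMap.add_apply, LinearMap.compAlternatingMap_apply,
    hρ x y] at h2 ⊢
  rw [h2]
  abel

/-! ### The Chevalley-Eilenberg differential with trivial coefficients -/

/-- `(a, b) ↦ α([a, b], …)`. -/
def bracketInsert {n : ℕ} (α : 𝔤 [⋀^Fin (n + 1)]→ₗ[ℝ] V) :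
    𝔤 →ₗ[ℝ] 𝔤 →ₗ[ℝ] 𝔤 [⋀^Fin n]→ₗ[ℝ] V :=
  LinearMap.mk₂ ℝ (fun a b ↦ α.curryLeft ⁅a, b⁆) (by intros; simp) (by intros; simp)
    (by intros; simp) (by intros; simp)

theorem bracketInsert_apply {n : ℕ} (α : 𝔤 [⋀^Fin (n + 1)]→ₗ[ℝ] V) (a b : 𝔤) :
    bracketInsert α a b = α.curryLeft ⁅a, b⁆ := rfl

/-- The Chevalley-Eilenberg differential in positive degree, up to the factor `-2`. -/
def ceAux {n : ℕ} (α : 𝔤 [⋀^Fin (n + 1)]→ₗ[ℝ] V) : 𝔤 [⋀^Fin (n + 2)]→ₗ[ℝ] V :=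
  AlternatingMap.alternatizeUncurryFin
    (AlternatingMap.alternatizeUncurryFinLM ∘ₗ bracketInsert α)

/-- The value of the Chevalley-Eilenberg differential, see `ceD`. -/
def ceFormula {n : ℕ} (α : 𝔤 [⋀^Fin (n + 1)]→ₗ[ℝ] V) (p : Fin (n + 2) → 𝔤) : V :=
  ∑ i : Fin (n + 1), ∑ j ≥ i, (-1 : ℝ) ^ (i + j + 1 : ℕ) •
    α (Fin.cons ⁅p i.castSucc, p j.succ⁆ (j.removeNth (i.castSucc.removeNth p)))

theorem ceFormula_eq {n : ℕ} (α : 𝔤 [⋀^Fin (n + 1)]→ₗ[ℝ] V) (p : Fin (n + 2) → 𝔤) :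
    ceFormula α p = ((-1 / 2 : ℝ) • ceAux α) p := by
  rw [AlternatingMap.smul_apply, ceAux,
    AlternatingMap.alternatizeUncurryFin_alternatizeUncurryFinLM_comp_apply, ceFormula,
    Finset.smul_sum]
  refine Finset.sum_congr rfl fun i _ ↦ ?_
  rw [Finset.smul_sum]
  refine Finset.sum_congr rfl fun j _ ↦ ?_
  rw [bracketInsert_apply, bracketInsert_apply, ← lie_skew (p j.succ), map_neg,
    AlternatingMap.neg_apply, ← Int.cast_smul_eq_zsmul ℝ, AlternatingMap.curryLeft_apply_apply,
    sub_neg_eq_add, ← two_smul ℝ (α _), smul_smul, smul_smul]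
  congr 1
  push_cast
  ring

/-- The Chevalley-Eilenberg differential `d_𝔤 : Λᵏ𝔤* ⊗ V → Λᵏ⁺¹𝔤* ⊗ V` with trivial
coefficients, the dual of the Lie algebra homology differential:
`(d_𝔤 α)(x₁, …, x_{k+1}) = ∑_{a < b} (-1)^{a+b} α([x_a, x_b], x₁, …, x̂_a, …, x̂_b, …, x_{k+1})`.
The pair `a < b` is encoded as `(i.castSucc, j.succ)` with `i ≤ j`. For `k = 0` the sum is empty. -/
def ceD : (k : ℕ) → (𝔤 [⋀^Fin k]→ₗ[ℝ] V) →ₗ[ℝ] (𝔤 [⋀^Fin (k + 1)]→ₗ[ℝ] V)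
  | 0 => 0
  | n + 1 =>
    { toFun := fun α ↦
        { toFun := ceFormula α
          map_update_add' := fun p i a b ↦ by
            rw [ceFormula_eq, ceFormula_eq, ceFormula_eq]
            exact ((-1 / 2 : ℝ) • ceAux α).map_update_add' p i a b
          map_update_smul' := fun p i c a ↦ by
            rw [ceFormula_eq, ceFormula_eq]
            exact ((-1 / 2 : ℝ) • ceAux α).map_update_smul' p i c a
          map_eq_zero_of_eq' := fun p i j h hij ↦ by
            change ceFormula α p = 0
            rw [ceFormula_eq]
            exact ((-1 / 2 : ℝ) • ceAux α).map_eq_zero_of_eq' p i j h hij }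
      map_add' := fun α β ↦ by
        ext p
        change ceFormula (α + β) p = ceFormula α p + ceFormula β p
        simp only [ceFormula, AlternatingMap.add_apply, smul_add, Finset.sum_add_distrib]
      map_smul' := fun c α ↦ by
        ext p
        change ceFormula (c • α) p = c • ceFormula α p
        simp only [ceFormula, AlternatingMap.smul_apply, Finset.smul_sum, smul_comm c] }

theorem ceD_succ_apply {n : ℕ} (α : 𝔤 [⋀^Fin (n + 1)]→ₗ[ℝ] V) (p : Fin (n + 2) → 𝔤) :
    ceD (n + 1) α p = ∑ i : Fin (n + 1), ∑ j ≥ i, (-1 : ℝ) ^ (i + j + 1 : ℕ) •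
      α (Fin.cons ⁅p i.castSucc, p j.succ⁆ (j.removeNth (i.castSucc.removeNth p))) := rfl

theorem ceD_succ_eq {n : ℕ} (α : 𝔤 [⋀^Fin (n + 1)]→ₗ[ℝ] V) :
    ceD (n + 1) α = (-1 / 2 : ℝ) • ceAux α := by
  ext p
  exact ceFormula_eq α p

theorem adSum_alternatizeUncurryFin {n : ℕ} (x : 𝔤) (f g : 𝔤 →ₗ[ℝ] 𝔤 [⋀^Fin n]→ₗ[ℝ] V)
    (hg : ∀ a, g a = adSum x (f a) + f ⁅x, a⁆) :
    adSum x (AlternatingMap.alternatizeUncurryFin f) =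
      AlternatingMap.alternatizeUncurryFin g := by
  ext p
  simp only [adSum_apply, AlternatingMap.alternatizeUncurryFin_apply, hg]
  rw [Finset.sum_comm]
  refine Finset.sum_congr rfl fun i _ ↦ ?_
  rw [← Finset.smul_sum, Fin.sum_univ_succAbove _ i]
  congr 1
  rw [AlternatingMap.add_apply, adSum_apply, add_comm]
  congr 1
  · refine Finset.sum_congr rfl fun j _ ↦ ?_
    rw [Function.update_of_ne (Fin.succAbove_ne i j).symm]
    congr 1
    rw [Fin.removeNth_update_succAbove]
    rfl
  · simp

theorem adSum_ceAux {n : ℕ} (x : 𝔤) (α : 𝔤 [⋀^Fin (n + 1)]→ₗ[ℝ] V) :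
    adSum x (ceAux α) = ceAux (adSum x α) := by
  have hc (c : 𝔤) : adSum x (α.curryLeft c) + α.curryLeft ⁅x, c⁆ = (adSum x α).curryLeft c := by
    ext p
    simp only [AlternatingMap.add_apply, adSum_apply, AlternatingMap.curryLeft_apply_apply]
    rw [Fin.sum_univ_succ, add_comm]
    congr 1
    · congr 1
      exact (Fin.update_cons_zero ..).symm
    · refine Finset.sum_congr rfl fun j _ ↦ ?_
      congr 1
      exact Fin.cons_update ..
  refine adSum_alternatizeUncurryFin x _ _ fun a ↦ ?_
  simp only [LinearMap.comp_apply, AlternatingMap.alternatizeUncurryFinLM_apply]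
  rw [adSum_alternatizeUncurryFin x (bracketInsert α a)
    (bracketInsert (adSum x α) a - bracketInsert α ⁅x, a⁆)]
  · rw [← AlternatingMap.alternatizeUncurryFin_add, sub_add_cancel]
  · intro b
    rw [LinearMap.sub_apply, bracketInsert_apply, bracketInsert_apply, bracketInsert_apply,
      bracketInsert_apply, ← hc, leibniz_lie x a b, map_add]
    abel

/-- The differential `d_𝔤` is `𝔤`-equivariant. -/
theorem ceD_cochainAct (ρ : 𝔤 →ₗ[ℝ] V →ₗ[ℝ] V) {k : ℕ} (x : 𝔤) (α : 𝔤 [⋀^Fin k]→ₗ[ℝ] V) :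
    ceD k (cochainAct ρ x α) = cochainAct ρ x (ceD k α) := by
  cases k with
  | zero => simp [ceD]
  | succ n =>
    have h1 : ceD (n + 1) (adSum x α) = adSum x (ceD (n + 1) α) := by
      rw [ceD_succ_eq, ceD_succ_eq, map_smul, adSum_ceAux]
    have h2 : ceD (n + 1) ((ρ x).compAlternatingMap α) =
        (ρ x).compAlternatingMap (ceD (n + 1) α) := by
      ext p
      simp only [ceD_succ_apply, LinearMap.compAlternatingMap_apply, map_sum, map_smul]
    change ceD (n + 1) ((ρ x).compAlternatingMap α - adSum x α) =
      (ρ x).compAlternatingMap (ceD (n + 1) α) - adSum x (ceD (n + 1) α)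
    rw [map_sub, h1, h2]

end Cochains

section LieCohomology

variable (𝔤 : Type*) [LieRing 𝔤] [LieAlgebra ℝ 𝔤]
variable (N : Type*) [AddCommGroup N] [Module ℝ N] [LieRingModule 𝔤 N] [LieModule ℝ 𝔤 N]

/-! ### First Lie algebra cohomology -/

/-- The differential `N → 𝔤* ⊗ N`, `m ↦ (x ↦ x · m)`. -/
def lieD₀₁ : N →ₗ[ℝ] LieModule.Cohomology.oneCochain ℝ 𝔤 N :=
  LinearMap.mk₂ ℝ (fun (m : N) (x : 𝔤) ↦ ⁅x, m⁆) (by intros; simp) (by intros; simp)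
    (by intros; simp) (by intros; simp)

theorem lieD₀₁_apply (m : N) (x : 𝔤) : lieD₀₁ 𝔤 N m x = ⁅x, m⁆ := rfl

/-- Lie algebra `1`-cocycles: linear maps `c : 𝔤 → N` with `x · c(y) - y · c(x) - c([x, y]) = 0`. -/
def oneCocycle : Submodule ℝ (LieModule.Cohomology.oneCochain ℝ 𝔤 N) :=
  LinearMap.ker (LieModule.Cohomology.d₁₂ ℝ 𝔤 N)

theorem range_lieD₀₁_le : LinearMap.range (lieD₀₁ 𝔤 N) ≤ oneCocycle 𝔤 N := by
  rintro _ ⟨m, rfl⟩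
  rw [oneCocycle, LinearMap.mem_ker]
  refine Subtype.ext ?_
  ext x y
  simp [lieD₀₁_apply]

/-- The first Lie algebra cohomology `H¹(𝔤, N)`: cocycles modulo coboundaries. -/
abbrev LieH1 : Type _ :=
  (oneCocycle 𝔤 N) ⧸ (LinearMap.range (lieD₀₁ 𝔤 N)).submoduleOf (oneCocycle 𝔤 N)

/-- The cohomology class of a cocycle. -/
def cohomologyClass {𝔤 : Type*} [LieRing 𝔤] [LieAlgebra ℝ 𝔤] {N : Type*} [AddCommGroup N]
    [Module ℝ N] [LieRingModule 𝔤 N] [LieModule ℝ 𝔤 N] (c : oneCocycle 𝔤 N) : LieH1 𝔤 N :=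
  Submodule.Quotient.mk c

end LieCohomology

section Action

variable {E : Type*} [NormedAddCommGroup E] [NormedSpace ℝ E] [FiniteDimensional ℝ E]
variable {M : Type*} [TopologicalSpace M] [ChartedSpace E M] [IsManifold 𝓘(ℝ, E) ∞ M]
variable {𝔤 : Type*} [LieRing 𝔤] [LieAlgebra ℝ 𝔤]

/-! ### Lie algebra actions -/

/-- An action of the Lie algebra `𝔤` on `M`: a homomorphism of Lie algebras
`𝔤 → 𝔛(M)`, `x ↦ v_x`. -/
structure LieAction (𝔤 : Type*) [LieRing 𝔤] [LieAlgebra ℝ 𝔤]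
    (E : Type*) [NormedAddCommGroup E] [NormedSpace ℝ E]
    (M : Type*) [TopologicalSpace M] [ChartedSpace E M] [IsManifold 𝓘(ℝ, E) ∞ M] where
  /-- The infinitesimal generators `v_x`. -/
  vec : 𝔤 →ₗ[ℝ] VField E M
  vec_lie : ∀ x y : 𝔤, IsLieBracket (vec x) (vec y) (vec ⁅x, y⁆)

theorem iota_add {k : ℕ} (X Y : VField E M) (η : DForm E M (k + 1)) :
    iota (X + Y) η = iota X η + iota Y η := by
  refine ContMDiffSection.ext fun m ↦ ?_
  exact map_add ((show E [⋀^Fin (k + 1)]→L[ℝ] ℝ from η m).curryLeft) (X m) (Y m)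

theorem iota_smul {k : ℕ} (c : ℝ) (X : VField E M) (η : DForm E M (k + 1)) :
    iota (c • X) η = c • iota X η := by
  refine ContMDiffSection.ext fun m ↦ ?_
  exact map_smul ((show E [⋀^Fin (k + 1)]→L[ℝ] ℝ from η m).curryLeft) c (X m)

theorem lieD_add_left (X Y : VField E M) {k : ℕ} (η : DForm E M k) :
    lieD (X + Y) k η = lieD X k η + lieD Y k η := by
  cases k with
  | zero => exact iota_add X Y _
  | succ k =>
    simp only [lieD, LinearMap.add_apply, LinearMap.comp_apply, iota_add, map_add]
    abel

theorem lieD_smul_left (c : ℝ) (X : VField E M) {k : ℕ} (η : DForm E M k) :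
    lieD (c • X) k η = c • lieD X k η := by
  cases k with
  | zero => exact iota_smul c X _
  | succ k =>
    simp only [lieD, LinearMap.add_apply, LinearMap.comp_apply, iota_smul, map_smul]
    exact (smul_add c (extD k (iota X η)) (iota X (extD (k + 1) η))).symm

/-- The representation of `𝔤` on `Ωʲ(M)` by Lie derivatives along the generators. -/
noncomputable def LieAction.rep (v : LieAction 𝔤 E M) (j : ℕ) :
    𝔤 →ₗ[ℝ] DForm E M j →ₗ[ℝ] DForm E M j :=
  LinearMap.mk₂ ℝ (fun x η ↦ lieD (v.vec x) j η)
    (fun x y η ↦ by rw [map_add, lieD_add_left]) (fun c x η ↦ by rw [map_smul, lieD_smul_left])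
    (fun x η θ ↦ map_add _ _ _) (fun c x η ↦ map_smul _ _ _)

theorem LieAction.rep_apply (v : LieAction 𝔤 E M) (j : ℕ) (x : 𝔤) (η : DForm E M j) :
    v.rep j x η = lieD (v.vec x) j η := rfl

/-! ### Contraction with the generators -/

/-- `ι_{v_p} η = ι_{v_{p_k}} ⋯ ι_{v_{p_1}} η` for `p = (p₁, …, p_k)`. -/
noncomputable def LieAction.contractFun (v : LieAction 𝔤 E M) {j : ℕ} :
    (k : ℕ) → (Fin k → 𝔤) → DForm E M (j + k) → DForm E M j
  | 0, _, η => η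
  | k + 1, p, η => v.contractFun k (Fin.tail p) (iota (v.vec (p 0)) η)

/-- The tuple `(v_{p_1}, …, v_{p_k}, w₁, …, w_j)` of tangent vectors at `m`. -/
noncomputable def LieAction.tuple (v : LieAction 𝔤 E M) {k j : ℕ} (p : Fin k → 𝔤) (m : M)
    (w : Fin j → TangentSpace 𝓘(ℝ, E) m) (i : Fin (j + k)) : TangentSpace 𝓘(ℝ, E) m :=
  if h : (i : ℕ) < k then v.vec (p ⟨i, h⟩) m else w ⟨i - k, by omega⟩

theorem LieAction.contractFun_apply (v : LieAction 𝔤 E M) {k j : ℕ} (p : Fin k → 𝔤)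
    (η : DForm E M (j + k)) (m : M) (w : Fin j → TangentSpace 𝓘(ℝ, E) m) :
    v.contractFun k p η m w = η m (v.tuple p m w) := by
  induction k with
  | zero =>
    refine congrArg (η m) (funext fun i ↦ ?_)
    simp [LieAction.tuple]
  | succ k ih =>
    rw [LieAction.contractFun, ih, iota_apply]
    refine congrArg (η m) (funext fun i ↦ ?_)
    refine Fin.cases ?_ (fun l ↦ ?_) i
    · simp [LieAction.tuple]
    · simp only [Fin.cons_succ, LieAction.tuple, Fin.val_succ, Nat.add_lt_add_iff_right]
      split
      · rfl
      · congr 2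
        omega

theorem LieAction.tuple_update (v : LieAction 𝔤 E M) {k j : ℕ} (p : Fin k → 𝔤) (m : M)
    (w : Fin j → TangentSpace 𝓘(ℝ, E) m) (i : Fin k) (a : 𝔤) :
    v.tuple (Function.update p i a) m w =
      Function.update (v.tuple p m w) ⟨i, by omega⟩ (v.vec a m) := by
  funext l
  by_cases h : l = ⟨i, by omega⟩
  · subst h
    simp [LieAction.tuple]
  · rw [Function.update_of_ne h]
    simp only [LieAction.tuple]
    split
    · rw [Function.update_of_ne]
      rintro rfl
      exact h rfl
    · rfl

/-- The contraction `p ↦ ι_{v_p} η` as an alternating map, i.e. an element of `Λᵏ𝔤* ⊗ Ωʲ(M)`. -/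
noncomputable def LieAction.contract (v : LieAction 𝔤 E M) (k j : ℕ) (η : DForm E M (j + k)) :
    𝔤 [⋀^Fin k]→ₗ[ℝ] DForm E M j where
  toFun p := v.contractFun k p η
  map_update_add' := by
    intro inst p i a b
    obtain rfl : inst = instDecidableEqFin k := Subsingleton.elim _ _
    refine ContMDiffSection.ext fun m ↦ ContinuousAlternatingMap.ext fun w ↦ ?_
    change _ = v.contractFun k _ η m w + v.contractFun k _ η m w
    simp only [LieAction.contractFun_apply, LieAction.tuple_update, map_add]
    exact (η m).map_update_add _ _ _ _
  map_update_smul' := by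
    intro inst p i c a
    obtain rfl : inst = instDecidableEqFin k := Subsingleton.elim _ _
    refine ContMDiffSection.ext fun m ↦ ContinuousAlternatingMap.ext fun w ↦ ?_
    change _ = c • v.contractFun k _ η m w
    simp only [LieAction.contractFun_apply, LieAction.tuple_update, map_smul]
    exact (η m).map_update_smul _ _ _ _
  map_eq_zero_of_eq' := by
    intro p i l h hil
    refine ContMDiffSection.ext fun m ↦ ContinuousAlternatingMap.ext fun w ↦ ?_
    change v.contractFun k p η m w = 0
    rw [LieAction.contractFun_apply]
    refine (η m).map_eq_zero_of_eq _ (i := ⟨i, by omega⟩) (j := ⟨l, by omega⟩) ?_ ?_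
    · simp [LieAction.tuple, h]
    · intro heq
      exact hil (Fin.ext (by simpa using heq))

/-! ### The total complex -/

/-- The total complex `C̃ = Λ^{≥1}𝔤* ⊗ Ω(M)`: an element has a component in
`Λ^{k+1}𝔤* ⊗ Ωʲ(M)` for all `k, j ≥ 0`. The elements of `Λ^{k+1}𝔤* ⊗ Ωʲ(M)` are viewed as
alternating maps. For finite dimensional `𝔤` and `M` all but finitely many of the factors vanish,
so the product is the direct sum. The argument `v` only serves to equip `C̃` with its structure of
a `𝔤`-module. -/
def BigComplex (_v : LieAction 𝔤 E M) : Type _ :=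
  (k j : ℕ) → 𝔤 [⋀^Fin (k + 1)]→ₗ[ℝ] DForm E M j

namespace BigComplex

variable {v : LieAction 𝔤 E M}

noncomputable instance : AddCommGroup (BigComplex v) :=
  inferInstanceAs (AddCommGroup ((k j : ℕ) → 𝔤 [⋀^Fin (k + 1)]→ₗ[ℝ] DForm E M j))

noncomputable instance : Module ℝ (BigComplex v) :=
  inferInstanceAs (Module ℝ ((k j : ℕ) → 𝔤 [⋀^Fin (k + 1)]→ₗ[ℝ] DForm E M j))

/-- The Lie algebra acts on `C̃` by `(x · α)(p) = £_{v_x} (α(p)) - α(ad_x p)`. -/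
noncomputable instance : LieRingModule 𝔤 (BigComplex v) where
  bracket x α := fun k j ↦ cochainAct (v.rep j) x (α k j)
  add_lie x y α := by
    funext k j
    change cochainAct (v.rep j) (x + y) (α k j) =
      cochainAct (v.rep j) x (α k j) + cochainAct (v.rep j) y (α k j)
    ext1 p
    change v.rep j (x + y) (α k j p) - adSum (x + y) (α k j) p =
      (v.rep j x (α k j p) - adSum x (α k j) p) + (v.rep j y (α k j p) - adSum y (α k j) p)
    rw [map_add, adSum_add, LinearMap.add_apply, AlternatingMap.add_apply]
    abel
  lie_add x α β := by
    funext k j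
    exact map_add (cochainAct (v.rep j) x) (α k j) (β k j)
  leibniz_lie x y α := by
    funext k j
    change cochainAct (v.rep j) x (cochainAct (v.rep j) y (α k j)) =
      cochainAct (v.rep j) ⁅x, y⁆ (α k j) + cochainAct (v.rep j) y (cochainAct (v.rep j) x (α k j))
    exact (cochainAct_lie (v.rep j) (fun a b η ↦ lieD_lieD (v.vec_lie a b) η) x y (α k j)).trans
      (add_comm _ _)

theorem lie_apply (x : 𝔤) (α : BigComplex v) (k j : ℕ) (p : Fin (k + 1) → 𝔤) :
    (⁅x, α⁆ : BigComplex v) k j p =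
      lieD (v.vec x) j (α k j p) - ∑ i, α k j (Function.update p i ⁅x, p i⁆) := rfl

noncomputable instance : LieModule ℝ 𝔤 (BigComplex v) where
  smul_lie c x α := by
    funext k j
    change cochainAct (v.rep j) (c • x) (α k j) = c • cochainAct (v.rep j) x (α k j)
    ext1 p
    change v.rep j (c • x) (α k j p) - adSum (c • x) (α k j) p =
      c • (v.rep j x (α k j p) - adSum x (α k j) p)
    rw [map_smul, adSum_smul, LinearMap.smul_apply, AlternatingMap.smul_apply]
    exact (smul_sub c _ _).symm
  lie_smul c x α := by
    funext k j
    exact map_smul (cochainAct (v.rep j) x) c (α k j)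

/-- The Chevalley-Eilenberg part `d_𝔤 ⊗ 1`; there is nothing mapping into `Λ¹𝔤* ⊗ Ω(M)`. -/
noncomputable def ceComp (α : BigComplex v) : (k j : ℕ) → 𝔤 [⋀^Fin (k + 1)]→ₗ[ℝ] DForm E M j
  | 0, _ => 0
  | k + 1, j => ceD (k + 1) (α k j)

/-- The de Rham part `p ↦ d(α(p))`; there is nothing mapping into `Λ𝔤* ⊗ Ω⁰(M)`. -/
noncomputable def deRhamComp (α : BigComplex v) :
    (k j : ℕ) → 𝔤 [⋀^Fin (k + 1)]→ₗ[ℝ] DForm E M j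
  | _, 0 => 0
  | k, j + 1 => (extD j).compAlternatingMap (α k j)

/-- The total differential `d̃_tot = d_𝔤 ⊗ 1 + 1 ⊗ d`. By the Koszul sign rule `1 ⊗ d` acts on
`Λᵏ𝔤* ⊗ Ω(M)` as `(-1)ᵏ d`. -/
noncomputable def dTot : BigComplex v →ₗ[ℝ] BigComplex v where
  toFun α := fun k j ↦ ceComp α k j + (-1 : ℝ) ^ (k + 1) • deRhamComp α k j
  map_add' α β := by
    funext k j
    have h1 : ceComp (α + β) k j = ceComp α k j + ceComp β k j := by
      cases k with
      | zero => simp [ceComp]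
      | succ k => exact map_add (ceD (k + 1)) (α k j) (β k j)
    have h2 : deRhamComp (α + β) k j = deRhamComp α k j + deRhamComp β k j := by
      cases j with
      | zero => simp [deRhamComp]
      | succ j =>
        ext1 p
        exact map_add (extD j) (α k j p) (β k j p)
    change ceComp (α + β) k j + (-1 : ℝ) ^ (k + 1) • deRhamComp (α + β) k j =
      (ceComp α k j + (-1 : ℝ) ^ (k + 1) • deRhamComp α k j) +
        (ceComp β k j + (-1 : ℝ) ^ (k + 1) • deRhamComp β k j)
    rw [h1, h2, smul_add]
    abel
  map_smul' c α := by
    funext k j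
    have h1 : ceComp (c • α) k j = c • ceComp α k j := by
      cases k with
      | zero => simp [ceComp]
      | succ k => exact map_smul (ceD (k + 1)) c (α k j)
    have h2 : deRhamComp (c • α) k j = c • deRhamComp α k j := by
      cases j with
      | zero => simp [deRhamComp]
      | succ j =>
        ext1 p
        exact map_smul (extD j) c (α k j p)
    change ceComp (c • α) k j + (-1 : ℝ) ^ (k + 1) • deRhamComp (c • α) k j =
      c • (ceComp α k j + (-1 : ℝ) ^ (k + 1) • deRhamComp α k j)
    rw [h1, h2, smul_add, smul_comm]

/-- The total differential is `𝔤`-equivariant. -/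
theorem dTot_lie (x : 𝔤) (α : BigComplex v) : dTot ⁅x, α⁆ = ⁅x, dTot α⁆ := by
  funext k j
  have h1 : ceComp ⁅x, α⁆ k j = cochainAct (v.rep j) x (ceComp α k j) := by
    cases k with
    | zero => exact (map_zero (cochainAct (v.rep j) x)).symm
    | succ k => exact ceD_cochainAct (v.rep j) x (α k j)
  have h2 : deRhamComp ⁅x, α⁆ k j = cochainAct (v.rep j) x (deRhamComp α k j) := by
    cases j with
    | zero => exact (map_zero (cochainAct (v.rep 0) x)).symm
    | succ j =>
      ext1 p
      change extD j (lieD (v.vec x) j (α k j p) - ∑ i, α k j (Function.update p i ⁅x, p i⁆)) =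
        lieD (v.vec x) (j + 1) (extD j (α k j p)) -
          ∑ i, extD j (α k j (Function.update p i ⁅x, p i⁆))
      rw [map_sub, map_sum, lieD_extD]
  change ceComp ⁅x, α⁆ k j + (-1 : ℝ) ^ (k + 1) • deRhamComp ⁅x, α⁆ k j =
    cochainAct (v.rep j) x (ceComp α k j + (-1 : ℝ) ^ (k + 1) • deRhamComp α k j)
  rw [h1, h2, map_add, map_smul]

end BigComplex

/-- The `𝔤`-submodule `𝒩 ⊆ C̃` of `d̃_tot`-closed elements. -/
noncomputable def closedElements (v : LieAction 𝔤 E M) : LieSubmodule ℝ 𝔤 (BigComplex v) where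
  toSubmodule := LinearMap.ker BigComplex.dTot
  lie_mem := by
    intro x α hα
    change BigComplex.dTot ⁅x, α⁆ = 0
    have h : BigComplex.dTot α = 0 := hα
    rw [BigComplex.dTot_lie, h, lie_zero]

/-! ### Multisymplectic manifolds and homotopy moment maps -/

/-- The `(n+1)`-form `Ω₀` is `n`-plectic: closed and nondegenerate. -/
structure IsNPlectic (n : ℕ) (Ω₀ : DForm E M (n + 1)) : Prop where
  closed : extD (n + 1) Ω₀ = 0
  nondegenerate : ∀ (m : M) (u : TangentSpace 𝓘(ℝ, E) m),
    (∀ w : Fin n → TangentSpace 𝓘(ℝ, E) m,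
      Ω₀ m (Fin.cons u w : Fin (n + 1) → TangentSpace 𝓘(ℝ, E) m) = 0) → u = 0

/-- The action preserves the form: `£_{v_x} Ω₀ = 0` for all `x`. -/
def LieAction.Preserves (v : LieAction 𝔤 E M) {k : ℕ} (Ω₀ : DForm E M k) : Prop :=
  ∀ x : 𝔤, lieD (v.vec x) k Ω₀ = 0

/-- Transport of a form along an equality of degrees. -/
def DForm.castDeg {k l : ℕ} (h : l = k) (η : DForm E M k) : DForm E M l := h ▸ η

/-- `ω̃ = ∑_{k=1}^{n+1} (-1)^{k-1} ω_k`, where `ω_k(p) = ι_{v_p} ω` for `p ∈ Λᵏ𝔤`. -/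
noncomputable def omegaTilde (v : LieAction 𝔤 E M) {n : ℕ} (Ω₀ : DForm E M (n + 1)) :
    BigComplex v := fun k j ↦
  if h : j + (k + 1) = n + 1 then (-1 : ℝ) ^ k • v.contract (k + 1) j (Ω₀.castDeg h) else 0

/-- The sign `ζ(k) = -(-1)^{k(k+1)/2}`. -/
def zeta (k : ℕ) : ℝ := -(-1) ^ (k * (k + 1) / 2)

/-- A collection of linear maps `f_k : Λᵏ𝔤 → Ω^{n-k}(M)`, `1 ≤ k ≤ n`. Here `f k j _` is the map
`f_{k+1}`, with values in `Ωʲ(M)` for `j = n - (k + 1)`. -/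
abbrev MomentComponents (𝔤 : Type*) [LieRing 𝔤] [LieAlgebra ℝ 𝔤]
    (E : Type*) [NormedAddCommGroup E] [NormedSpace ℝ E]
    (M : Type*) [TopologicalSpace M] [ChartedSpace E M] [IsManifold 𝓘(ℝ, E) ∞ M] (n : ℕ) :
    Type _ :=
  (k j : ℕ) → k + 1 + j = n → 𝔤 [⋀^Fin (k + 1)]→ₗ[ℝ] DForm E M j

/-- The element `∑ₖ f_k` of `C̃`. -/
noncomputable def MomentComponents.total {n : ℕ} (f : MomentComponents 𝔤 E M n)
    (v : LieAction 𝔤 E M) : BigComplex v := fun k j ↦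
  if h : k + 1 + j = n then f k j h else 0

/-- `f` is a homotopy moment map for the action `v` on `(M, Ω₀)`:
`-f_{k-1}(δp) = d(f_k(p)) + ζ(k) ι_{v_p} Ω₀` for all `p ∈ Λᵏ𝔤`, `1 ≤ k ≤ n + 1`, where
`f₀ = f_{n+1} = 0`. As `(d_𝔤 f_{k-1})(p) = f_{k-1}(δp)`, the left hand side is the
Chevalley-Eilenberg part, and in terms of `k + 1` in place of `k` the equation takes values in
`Ωʲ(M)` with `j + (k + 1) = n + 1`. For `k = 1` the equation reads `d(f₁(x)) = -ι_{v_x} Ω₀`; in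
particular `f₁` takes values in Hamiltonian forms. -/
def IsHomotopyMomentMap (v : LieAction 𝔤 E M) {n : ℕ} (Ω₀ : DForm E M (n + 1))
    (f : MomentComponents 𝔤 E M n) : Prop :=
  ∀ (k j : ℕ) (h : j + (k + 1) = n + 1) (p : Fin (k + 1) → 𝔤),
    -((f.total v).ceComp k j p) =
      (f.total v).deRhamComp k j p + zeta (k + 1) • v.contract (k + 1) j (Ω₀.castDeg h) p

/-- `f` is `𝔤`-equivariant: `f_k(ad_x p) = £_{v_x} (f_k(p))` for all `x`, `p` and `1 ≤ k ≤ n`. -/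
def IsEquivariant (v : LieAction 𝔤 E M) {n : ℕ} (f : MomentComponents 𝔤 E M n) : Prop :=
  ∀ (k j : ℕ) (h : k + 1 + j = n) (x : 𝔤) (p : Fin (k + 1) → 𝔤),
    ∑ i, f k j h (Function.update p i ⁅x, p i⁆) = lieD (v.vec x) j (f k j h p)

/-- The element `α̃ = ∑ₖ ζ(k) f_k` of `C̃` that corresponds to `f`. -/
noncomputable def MomentComponents.potential {n : ℕ} (f : MomentComponents 𝔤 E M n)
    (v : LieAction 𝔤 E M) : BigComplex v := fun k j ↦ zeta (k + 1) • f.total v k j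

end Action
end Multisymplectic

open Multisymplectic

/-!
The equation defining a homotopy moment map is, bidegree by bidegree, the equation
`d̃_tot α̃ = ω̃` for the potential `α̃`: the signs match because `ζ(k) = (-1)ᵏ⁺¹ ζ(k + 1)`
(`isHomotopyMomentMap_iff_dTot_potential`). So potentials of homotopy moment maps are exactly the
primitives of `ω̃` which are concentrated in total degree `n`.

By Cartan calculus `£_{v_x} (ι_{v_p} ω) = ι_{v_{ad_x p}} ω + ι_{v_p} £_{v_x} ω`
(`LieAction.lieD_contract`), hence `ω̃` is `𝔤`-invariant if the action preserves `ω`. As `d̃_tot` is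
`𝔤`-equivariant, `x · α̃` is then closed, and `x ↦ x · α̃` is a cocycle with values in `𝒩`, being a
coboundary in `C̃` (`invarianceCocycle`). Two potentials differ by an element of `𝒩`, so their
cocycles differ by a coboundary. The class vanishes if and only if `x · α̃ = x · m` for some
`m ∈ 𝒩`; then `α̃ - m` is an invariant primitive of `ω̃`. Since `𝔤` preserves the bidegree and
`d̃_tot` raises the total degree by one, the part of `α̃ - m` of total degree `n` is an invariant
primitive as well, and it is the potential of an equivariant homotopy moment map.
-/

namespace Multisymplectic

section Potential

variable {E : Type*} [NormedAddCommGroup E] [NormedSpace ℝ E] [FiniteDimensional ℝ E]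
variable {M : Type*} [TopologicalSpace M] [ChartedSpace E M] [IsManifold 𝓘(ℝ, E) ∞ M]
variable {𝔤 : Type*} [LieRing 𝔤] [LieAlgebra ℝ 𝔤]
variable {v : LieAction 𝔤 E M}

/-! ### Signs and invariance of `ω̃` -/

theorem zeta_succ (k : ℕ) : zeta (k + 1) = (-1) ^ (k + 1) * zeta k := by
  have h : (k + 1) * (k + 1 + 1) / 2 = k * (k + 1) / 2 + (k + 1) := by
    rw [show (k + 1) * (k + 1 + 1) = k * (k + 1) + (k + 1) * 2 by ring,
      Nat.add_mul_div_right _ _ two_pos]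
  rw [zeta, zeta, h, pow_add]
  ring

theorem zeta_mul_self (k : ℕ) : zeta k * zeta k = 1 := by
  rw [zeta, neg_mul_neg, ← mul_pow]
  simp

theorem neg_one_pow_mul_zeta_succ (k : ℕ) : (-1) ^ (k + 1) * zeta (k + 1) = zeta k := by
  rw [zeta_succ, ← mul_assoc, ← mul_pow]
  simp

theorem zeta_mul_zeta_succ (k : ℕ) : zeta k * zeta (k + 1) = -(-1) ^ k := by
  rw [zeta_succ, mul_left_comm, zeta_mul_self, mul_one, pow_succ, mul_neg_one]

/-- `£_{v_x} (ι_{v_p} η) = ι_{v_{ad_x p}} η + ι_{v_p} (£_{v_x} η)`. -/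
theorem LieAction.lieD_contract (v : LieAction 𝔤 E M) (x : 𝔤) {k j : ℕ}
    (η : DForm E M (j + k)) (p : Fin k → 𝔤) :
    lieD (v.vec x) j (v.contract k j η p) =
      ∑ i, v.contract k j η (Function.update p i ⁅x, p i⁆) +
        v.contract k j (lieD (v.vec x) (j + k) η) p := by
  induction k with
  | zero =>
    rw [Fin.sum_univ_zero, zero_add]
    rfl
  | succ k ih =>
    have hstep (θ : DForm E M (j + (k + 1))) (q : Fin (k + 1) → 𝔤) :
        v.contract (k + 1) j θ q = v.contract k j (iota (v.vec (q 0)) θ) (Fin.tail q) := rfl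
    have hadd (θ θ' : DForm E M (j + k)) (q : Fin k → 𝔤) :
        v.contract k j (θ + θ') q = v.contract k j θ q + v.contract k j θ' q := by
      refine ContMDiffSection.ext fun m ↦ ContinuousAlternatingMap.ext fun w ↦ ?_
      change v.contractFun k q (θ + θ') m w = v.contractFun k q θ m w + v.contractFun k q θ' m w
      simp only [LieAction.contractFun_apply]
      rfl
    have hiota : lieD (v.vec x) (j + k) (iota (v.vec (p 0)) η) =
        iota (v.vec (p 0)) (lieD (v.vec x) (j + k + 1) η) + iota (v.vec ⁅x, p 0⁆) η :=
      lieD_iota (v.vec_lie x (p 0)) η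
    rw [hstep, ih, hiota, hadd, Fin.sum_univ_succ]
    simp only [hstep, Function.update_self, Fin.tail_update_zero, Fin.tail_update_succ]
    simp only [Function.update_of_ne (Fin.succ_ne_zero _).symm]
    exact (congrArg (_ + ·) (add_comm _ _)).trans ((add_left_comm _ _ _).trans
      (add_assoc _ _ _).symm)

theorem LieAction.Preserves.castDeg {k l : ℕ} {η : DForm E M k} (hη : v.Preserves η) (h : l = k) :
    v.Preserves (η.castDeg h) := by
  subst h
  exact hη

/-- If the action preserves `ω`, then `ω̃` is `𝔤`-invariant, because each contraction map
`p ↦ ι_{v_p} ω` is equivariant. -/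
theorem lie_omegaTilde {n : ℕ} {Ω₀ : DForm E M (n + 1)} (hv : v.Preserves Ω₀) (x : 𝔤) :
    ⁅x, omegaTilde v Ω₀⁆ = 0 := by
  funext k j
  ext1 p
  rw [BigComplex.lie_apply, omegaTilde]
  change _ = (0 : DForm E M j)
  split_ifs with h
  · simp only [AlternatingMap.smul_apply, map_smul, ← Finset.smul_sum]
    have hzero : v.contract (k + 1) j 0 p = 0 := by
      refine ContMDiffSection.ext fun m ↦ ContinuousAlternatingMap.ext fun w ↦ ?_
      exact v.contractFun_apply p 0 m w
    rw [v.lieD_contract, hv.castDeg h x, hzero, add_zero, sub_self]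
  · simp

/-! ### Homotopy moment maps as primitives -/

theorem dTot_potential_apply {n : ℕ} (f : MomentComponents 𝔤 E M n) (k j : ℕ) :
    BigComplex.dTot (f.potential v) k j =
      zeta k • ((f.total v).ceComp k j + (f.total v).deRhamComp k j) := by
  have h1 : (f.potential v).ceComp k j = zeta k • (f.total v).ceComp k j := by
    cases k with
    | zero => exact (smul_zero _).symm
    | succ k => exact map_smul (ceD (k + 1)) (zeta (k + 1)) (f.total v k j)
  have h2 : (f.potential v).deRhamComp k j = zeta (k + 1) • (f.total v).deRhamComp k j := by
    cases j with
    | zero => exact (smul_zero _).symm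
    | succ j =>
      ext1 p
      exact map_smul (extD j) (zeta (k + 1)) (f.total v k j p)
  change (f.potential v).ceComp k j + (-1 : ℝ) ^ (k + 1) • (f.potential v).deRhamComp k j = _
  rw [h1, h2, smul_smul, neg_one_pow_mul_zeta_succ, smul_add]

/-- The component of `d̃_tot α` of total degree `n + 1` only depends on the components of `α` of
total degree `n`. -/
theorem BigComplex.dTot_apply_congr {n : ℕ} {α β : BigComplex v}
    (h : ∀ k j, k + 1 + j = n → α k j = β k j) {k j : ℕ} (hkj : j + (k + 1) = n + 1) :
    dTot α k j = dTot β k j := by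
  have h1 : ceComp α k j = ceComp β k j := by
    cases k with
    | zero => rfl
    | succ k => exact congrArg (ceD (k + 1)) (h k j (by omega))
  have h2 : deRhamComp α k j = deRhamComp β k j := by
    cases j with
    | zero => rfl
    | succ j => exact congrArg (extD j).compAlternatingMap (h k j (by omega))
  change ceComp α k j + _ • deRhamComp α k j = ceComp β k j + _ • deRhamComp β k j
  rw [h1, h2]

theorem dTot_potential_of_ne {n : ℕ} (f : MomentComponents 𝔤 E M n) {k j : ℕ}
    (hkj : j + (k + 1) ≠ n + 1) : BigComplex.dTot (f.potential v) k j = 0 := by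
  -- The potential vanishes in total degree `j + k ≠ n`, where it is compared with `0`.
  have h : ∀ k' j', k' + 1 + j' = j + k → f.potential v k' j' = (0 : BigComplex v) k' j' := by
    intro k' j' h'
    have hne : ¬ k' + 1 + j' = n := by omega
    simp only [MomentComponents.potential, MomentComponents.total, dif_neg hne, smul_zero]
    rfl
  rw [BigComplex.dTot_apply_congr h (by omega), map_zero]
  rfl

theorem isHomotopyMomentMap_iff_dTot_potential {n : ℕ} {Ω₀ : DForm E M (n + 1)}
    {f : MomentComponents 𝔤 E M n} :
    IsHomotopyMomentMap v Ω₀ f ↔ BigComplex.dTot (f.potential v) = omegaTilde v Ω₀ := by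
  have hζ (k : ℕ) : zeta k ≠ 0 := left_ne_zero_of_mul_eq_one (zeta_mul_self k)
  have key (k j : ℕ) (h : j + (k + 1) = n + 1) :
      BigComplex.dTot (f.potential v) k j = omegaTilde v Ω₀ k j ↔
      ∀ p : Fin (k + 1) → 𝔤, -((f.total v).ceComp k j p) =
        (f.total v).deRhamComp k j p + zeta (k + 1) • v.contract (k + 1) j (Ω₀.castDeg h) p := by
    have hpow : (-1 : ℝ) ^ k = zeta k * -zeta (k + 1) := by
      rw [mul_neg, zeta_mul_zeta_succ, neg_neg]
    rw [dTot_potential_apply, omegaTilde, dif_pos h, hpow, mul_smul,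
      smul_right_inj (hζ k), AlternatingMap.ext_iff]
    refine forall_congr' fun p ↦ ?_
    have h_neg {a d w : DForm E M j} : a + d = -w ↔ -a = d + w := by
      rw [eq_neg_iff_add_eq_zero, neg_eq_iff_add_eq_zero, add_assoc]
    rw [neg_smul]
    exact h_neg
  constructor
  · intro hf
    funext k j
    by_cases h : j + (k + 1) = n + 1
    · exact (key k j h).2 (hf k j h)
    · rw [dTot_potential_of_ne f h, omegaTilde, dif_neg h]
  · intro hf k j h
    exact (key k j h).1 (congrFun (congrFun hf k) j)

/-- `f` is equivariant if and only if its potential is invariant. -/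
theorem isEquivariant_iff_lie_potential {n : ℕ} {f : MomentComponents 𝔤 E M n} :
    IsEquivariant v f ↔ ∀ x : 𝔤, ⁅x, f.potential v⁆ = 0 := by
  have hpot (k j : ℕ) (h : k + 1 + j = n) (x : 𝔤) (p : Fin (k + 1) → 𝔤) :
      ⁅x, f.potential v⁆ k j p = zeta (k + 1) •
        (lieD (v.vec x) j (f k j h p) - ∑ i, f k j h (Function.update p i ⁅x, p i⁆)) := by
    simp only [BigComplex.lie_apply, MomentComponents.potential, MomentComponents.total, dif_pos h,
      AlternatingMap.smul_apply, map_smul, ← Finset.smul_sum]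
    exact (smul_sub (zeta (k + 1)) (lieD (v.vec x) j (f k j h p)) _).symm
  constructor
  · intro hf x
    funext k j
    ext1 p
    change _ = (0 : DForm E M j)
    by_cases h : k + 1 + j = n
    · rw [hpot k j h, ← hf k j h, sub_self]
      exact smul_zero (A := DForm E M j) (zeta (k + 1))
    · simp [BigComplex.lie_apply, MomentComponents.potential, MomentComponents.total, dif_neg h]
  · intro hf k j h x p
    have h0 : ⁅x, f.potential v⁆ k j p = 0 := by
      rw [hf x]
      rfl
    rw [hpot k j h] at h0
    have hζ : zeta (k + 1) ≠ 0 := left_ne_zero_of_mul_eq_one (zeta_mul_self (k + 1))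
    exact (sub_eq_zero.1 ((smul_eq_zero.1 h0).resolve_left hζ)).symm

/-- The collection `f_k` whose potential is the part of `α` of total degree `n`. The factor is
`ζ(k)⁻¹ = ζ(k)`. -/
noncomputable def BigComplex.momentComponents (α : BigComplex v) (n : ℕ) :
    MomentComponents 𝔤 E M n := fun k j _ ↦ zeta (k + 1) • α k j

theorem BigComplex.potential_momentComponents (α : BigComplex v) {n k j : ℕ}
    (h : k + 1 + j = n) : (α.momentComponents n).potential v k j = α k j := by
  rw [MomentComponents.potential, MomentComponents.total, dif_pos h, momentComponents, smul_smul,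
    zeta_mul_self, one_smul]

theorem isHomotopyMomentMap_momentComponents {n : ℕ} {Ω₀ : DForm E M (n + 1)} {α : BigComplex v}
    (hα : BigComplex.dTot α = omegaTilde v Ω₀) :
    IsHomotopyMomentMap v Ω₀ (α.momentComponents n) := by
  rw [isHomotopyMomentMap_iff_dTot_potential]
  funext k j
  by_cases h : j + (k + 1) = n + 1
  · rw [BigComplex.dTot_apply_congr (fun _ _ ↦ α.potential_momentComponents) h, hα]
  · rw [dTot_potential_of_ne _ h, omegaTilde, dif_neg h]

theorem isEquivariant_momentComponents {α : BigComplex v} (hα : ∀ x : 𝔤, ⁅x, α⁆ = 0) (n : ℕ) :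
    IsEquivariant v (α.momentComponents n) := by
  intro k j h x p
  have h0 : ⁅x, α⁆ k j p = 0 := by
    rw [hα x]
    rfl
  rw [BigComplex.lie_apply, sub_eq_zero] at h0
  simp only [BigComplex.momentComponents, AlternatingMap.smul_apply, map_smul, h0, Finset.smul_sum]

/-! ### The obstruction class -/

/-- The cocycle `x ↦ x · α` with values in `𝒩`, for `α ∈ C̃` such that `d̃_tot α` is invariant. It
is a coboundary in `C̃`, but in general not in `𝒩`. -/
noncomputable def invarianceCocycle (α : BigComplex v)
    (hα : ∀ x : 𝔤, ⁅x, BigComplex.dTot α⁆ = 0) : oneCocycle 𝔤 (closedElements v) :=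
  ⟨{ toFun := fun x ↦ ⟨⁅x, α⁆, (BigComplex.dTot_lie x α).trans (hα x)⟩
     map_add' := fun x y ↦ Subtype.ext (add_lie x y α)
     map_smul' := fun c x ↦ Subtype.ext (smul_lie c x α) }, by
    rw [oneCocycle, LinearMap.mem_ker]
    refine Subtype.ext (LinearMap.ext fun x ↦ LinearMap.ext fun y ↦ Subtype.ext ?_)
    change ⁅x, ⁅y, α⁆⁆ - ⁅y, ⁅x, α⁆⁆ - ⁅⁅x, y⁆, α⁆ = 0
    rw [lie_lie, sub_self]⟩

theorem cohomologyClass_eq_iff {N : Type*} [AddCommGroup N] [Module ℝ N] [LieRingModule 𝔤 N]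
    [LieModule ℝ 𝔤 N] {c c' : oneCocycle 𝔤 N} :
    cohomologyClass c = cohomologyClass c' ↔ ∃ m : N, ∀ x : 𝔤, ⁅x, m⁆ = c.1 x - c'.1 x := by
  refine (Submodule.Quotient.eq _).trans ?_
  refine exists_congr fun m ↦ ?_
  exact LinearMap.ext_iff

theorem cohomologyClass_eq_zero_iff {N : Type*} [AddCommGroup N] [Module ℝ N] [LieRingModule 𝔤 N]
    [LieModule ℝ 𝔤 N] {c : oneCocycle 𝔤 N} :
    cohomologyClass c = 0 ↔ ∃ m : N, ∀ x : 𝔤, ⁅x, m⁆ = c.1 x := by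
  refine (cohomologyClass_eq_iff (c' := 0)).trans ?_
  simp

end Potential

end Multisymplectic

open Multisymplectic

theorem mainTheorem7
    {E : Type*} [NormedAddCommGroup E] [NormedSpace ℝ E] [FiniteDimensional ℝ E]
    {M : Type*} [TopologicalSpace M] [ChartedSpace E M] [IsManifold 𝓘(ℝ, E) ∞ M]
    [T2Space M] [SecondCountableTopology M]
    {𝔤 : Type*} [LieRing 𝔤] [LieAlgebra ℝ 𝔤] [FiniteDimensional ℝ 𝔤]
    {n : ℕ} (Ω₀ : DForm E M (n + 1)) (hΩ : IsNPlectic n Ω₀)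
    (v : LieAction 𝔤 E M) (hv : v.Preserves Ω₀)
    (f : MomentComponents 𝔤 E M n) (hf : IsHomotopyMomentMap v Ω₀ f) :
    BigComplex.dTot (f.potential v) = omegaTilde v Ω₀ ∧
    ∃ z : oneCocycle 𝔤 (closedElements v),
      (∀ x : 𝔤, ((z.1 x : closedElements v) : BigComplex v) = ⁅x, f.potential v⁆) ∧
      (∀ f' : MomentComponents 𝔤 E M n, IsHomotopyMomentMap v Ω₀ f' →
        ∃ z' : oneCocycle 𝔤 (closedElements v),
          (∀ x : 𝔤, ((z'.1 x : closedElements v) : BigComplex v) = ⁅x, f'.potential v⁆) ∧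
          cohomologyClass z' = cohomologyClass z) ∧
      (cohomologyClass z = 0 ↔
        ∃ f' : MomentComponents 𝔤 E M n, IsHomotopyMomentMap v Ω₀ f' ∧ IsEquivariant v f') := by
  have hdTot {g : MomentComponents 𝔤 E M n} (hg : IsHomotopyMomentMap v Ω₀ g) :
      BigComplex.dTot (g.potential v) = omegaTilde v Ω₀ :=
    isHomotopyMomentMap_iff_dTot_potential.1 hg
  have hinv {g : MomentComponents 𝔤 E M n} (hg : IsHomotopyMomentMap v Ω₀ g) (x : 𝔤) :
      ⁅x, BigComplex.dTot (g.potential v)⁆ = 0 := by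
    rw [hdTot hg, lie_omegaTilde hv]
  have hclosed {g g' : MomentComponents 𝔤 E M n} (hg : IsHomotopyMomentMap v Ω₀ g)
      (hg' : IsHomotopyMomentMap v Ω₀ g') : g.potential v - g'.potential v ∈ closedElements v := by
    change BigComplex.dTot (g.potential v - g'.potential v) = 0
    rw [map_sub, hdTot hg, hdTot hg', sub_self]
  refine ⟨hdTot hf, invarianceCocycle (f.potential v) (hinv hf), fun x ↦ rfl, ?_, ?_⟩
  · intro f' hf'
    refine ⟨invarianceCocycle (f'.potential v) (hinv hf'), fun x ↦ rfl, ?_⟩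
    exact cohomologyClass_eq_iff.2 ⟨⟨_, hclosed hf' hf⟩, fun x ↦ Subtype.ext (lie_sub x _ _)⟩
  · rw [cohomologyClass_eq_zero_iff]
    constructor
    · rintro ⟨m, hm⟩
      have hm_closed : BigComplex.dTot (m : BigComplex v) = 0 := m.2
      refine ⟨(f.potential v - m : BigComplex v).momentComponents n,
        isHomotopyMomentMap_momentComponents ?_, isEquivariant_momentComponents (fun x ↦ ?_) n⟩
      · rw [map_sub, hdTot hf, hm_closed, sub_zero]
      · have hx : ⁅x, (m : BigComplex v)⁆ = ⁅x, f.potential v⁆ := congrArg Subtype.val (hm x)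
        rw [lie_sub, hx, sub_self]
    · rintro ⟨f', hf', hequiv⟩
      refine ⟨⟨_, hclosed hf hf'⟩, fun x ↦ Subtype.ext ?_⟩
      change ⁅x, f.potential v - f'.potential v⁆ = ⁅x, f.potential v⁆
      rw [lie_sub, isEquivariant_iff_lie_potential.1 hequiv x, sub_zero]
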